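/- For $N\ge 2$, a secret $s\in\mathbb Z_N$ and arbitrary shifts $x_k\in\mathbb Z_N$, the input of the Gaussian extrapolated dihedral coset problem $\mathrm{G\text{-}EDCP}_{1,N,r}^{\ell}$ consists of the $\ell$ normalized quantum states proportional to $\sum_{j}\rho_r(j)\,|j\rangle|x_k+js \bmod N\rangle$ ($1\le k\le\ell$), where $\rho_r(j)=e^{-\pi j^2/r^2}$ and the integer $j$ is stored in a finite register, that is, $|j|\le B$ for an integer $B\ge\sqrt{\kappa}\,r$. The input of the dihedral coset problem $\mathrm{DCP}_N^{\ell'}$ with secret $s$ consists of $\ell'$ states $\tfrac1{\sqrt2}\big(|0\rangle|x_i\rangle+|1\rangle|x_i+s \bmod N\rangle\big)$ with arbitrary $x_i\in\mathbb Z_N$. In both problems the task is to find $s$. A solver for $\mathrm{DCP}_N^{\ell'}$ with success probability $p$ is a quantum measurement of the $\ell'$ registers, with outcomes in $\mathbb Z_N$ or no answer, that for every secret and all shifts returns the secret with probability at least $p$. **Lemma.** There is a quantum algorithm with measurements (a probabilistic reduction, given $N,\ell,\ell',\kappa$ and the input states, and calling a $\mathrm{DCP}_N^{\ell'}$ solver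 once) and a polynomial $T$ such that for every $r_0>0$ there are constants $c,\delta>0$ for which the following holds. Let $\kappa\ge1$, $N\ge2$, $\ell,\ell'\ge0$ and $B$ be integers and $r\ge r_0$ a real number with $B\ge\sqrt\kappa\, r$, and suppose that $$r\ge 3\ln N \ \text{ and }\ \ell'\le c\,\frac{\ell}{\log r\cdot\kappa^2},\qquad\text{or}\qquad r<3\log_2 N\ \text{ and }\ \ell'\le c\,\frac{\ell}{r\cdot\kappa}.$$ Then, for all $s$ and all $x_k$, on the $\mathrm{G\text{-}EDCP}_{1,N,r}^{\ell}$ input with secret $s$: 1. the algorithm runs in time at most $T(\kappa+\ell+|N|+|B|)$, where $|\cdot|$ is the bit length and the call of the solver is not counted (so in time polynomial in $\kappa$ when $\ell$, $\log N$ and $\log B$ are polynomial in $\kappa$); 2. with probability at least $1-2^{-\delta\kappa}$ the registers on which it calls the solver hold $\ell'$ $\mathrm{DCP}_N$ states with secret $2s$ (in tensor product with the rest of the memory); 3. for every solver for $\mathrm{DCP}_N^{\ell'}$ with success probability $p$, the algorithm using this solver outputs $s$ with probability at least $\tfrac p2\,(1-2^{-\delta\kappa})$. Here $\log r$ is the natural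 logarithm. In particular this gives reductions from $\mathrm{G\text{-}EDCP}_{1,N,r}^{\ell}$ to $\mathrm{DCP}_N^{\Theta(\ell/(\log r\cdot\kappa^2))}$ if $r\ge 3\log N$, and to $\mathrm{DCP}_N^{\Theta(\ell/(r\cdot\kappa))}$ otherwise, whether $\log N$ is read to base $e$ or $2$. -/

import Mathlib

noncomputable section

namespace CosetReduction

/-! ## A quantum random access machine with a logarithmic cost measure

The machine has a classical memory and a quantum memory.  Memory cells hold natural numbers, the
control flow and the addresses are classical, and every instruction is charged the bit lengths of
all the numbers which it handles. -/

/-- Arithmetic operations on natural numbers (`sub` is truncated subtraction). -/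
inductive ArithOp
  | add
  | sub
  | mul
  | div
  | mod

/-- The value of an arithmetic operation. -/
def ArithOp.eval : ArithOp → ℕ → ℕ → ℕ
  | .add, m, n => m + n
  | .sub, m, n => m - n
  | .mul, m, n => m * n
  | .div, m, n => m / n
  | .mod, m, n => m % n

/-- Classical expressions: `get a` is the content of the classical cell whose address is the value
of `a`, and `size a` is the bit length of the value of `a`. -/
inductive CExpr
  | lit (n : ℕ)
  | get (a : CExpr)
  | size (a : CExpr)
  | op (o : ArithOp) (a b : CExpr)

/-- The value of a classical expression in the classical memory `c`. -/
def CExpr.eval (c : ℕ → ℕ) : CExpr → ℕ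
  | .lit n => n
  | .get a => c (a.eval c)
  | .size a => Nat.size (a.eval c)
  | .op o a b => o.eval (a.eval c) (b.eval c)

/-- The time for evaluating a classical expression: the number of its nodes plus the bit lengths
of the values of all its subexpressions. -/
def CExpr.cost (c : ℕ → ℕ) : CExpr → ℕ
  | .lit n => 1 + Nat.size n
  | .get a => a.cost c + 1 + Nat.size (c (a.eval c))
  | .size a => a.cost c + 1 + Nat.size (Nat.size (a.eval c))
  | .op o a b => a.cost c + b.cost c + 1 + Nat.size (o.eval (a.eval c) (b.eval c))

/-- Expressions which may read the quantum memory: `get a` is the content of the quantum cell whose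
address is the value of the classical expression `a`. -/
inductive QExpr
  | ofC (a : CExpr)
  | get (a : CExpr)
  | op (o : ArithOp) (a b : QExpr)

/-- The value of a quantum expression on the basis state `q` of the quantum memory. -/
def QExpr.eval (c : ℕ → ℕ) (q : ℕ →₀ ℕ) : QExpr → ℕ
  | .ofC a => a.eval c
  | .get a => q (a.eval c)
  | .op o a b => o.eval (a.eval c q) (b.eval c q)

/-- The time for evaluating a quantum expression on the basis state `q`. -/
def QExpr.cost (c : ℕ → ℕ) (q : ℕ →₀ ℕ) : QExpr → ℕ
  | .ofC a => a.cost c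
  | .get a => a.cost c + 1 + Nat.size (q (a.eval c))
  | .op o a b => a.cost c q + b.cost c q + 1 + Nat.size (o.eval (a.eval c q) (b.eval c q))

/-- Vectors of the quantum memory: finite superpositions of basis states `q : ℕ →₀ ℕ`, where `q a`
is the content of the cell `a`.  They need not be normalized. -/
abbrev QVec : Type := (ℕ →₀ ℕ) →₀ ℂ

/-- The squared norm of a vector of the quantum memory. -/
def QVec.normSq (ψ : QVec) : ℝ := ∑ q ∈ ψ.support, ‖ψ q‖ ^ 2

/-- The permutation of the basis states which replaces the content `y` of the cell `a` by
`y ⊕ f z` (bitwise), where `z` is the content of all the other cells. -/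
def xorBasis (a : ℕ) (f : (ℕ →₀ ℕ) → ℕ) (q : ℕ →₀ ℕ) : ℕ →₀ ℕ :=
  q.update a (q a ^^^ f (q.erase a))

/-- `xorBasis a f` is an involution, so that it extends to a unitary operator. -/
theorem xorBasis_involutive (a : ℕ) (f : (ℕ →₀ ℕ) → ℕ) :
    Function.Involutive (xorBasis a f) := by
  intro q
  have h : (xorBasis a f q).erase a = q.erase a := by
    ext b
    by_cases hb : b = a
    · simp [hb]
    · simp [xorBasis, Finsupp.erase_ne hb]
  ext b
  by_cases hb : b = a
  · subst hb
    conv_lhs => rw [xorBasis, h]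
    simp [xorBasis]
  · conv_lhs => rw [xorBasis]
    simp [xorBasis]

/-- The unitary operator given by `xorBasis`. -/
def QVec.xor (a : ℕ) (f : (ℕ →₀ ℕ) → ℕ) (ψ : QVec) : QVec := ψ.mapDomain (xorBasis a f)

/-- The Hadamard gate on the cell `a` (the identity where the content of `a` is not `0` or `1`). -/
def QVec.hadamard (a : ℕ) (ψ : QVec) : QVec :=
  ψ.sum fun q z =>
    if q a ≤ 1 then
      Finsupp.single (q.update a 0) (z / (√2 : ℝ)) +
        Finsupp.single (q.update a 1) ((-1) ^ (q a) * z / (√2 : ℝ))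
    else Finsupp.single q z

/-- The `π/8` gate on the cell `a`: the phase `exp(iπ/4)` where the content of `a` is `1`. -/
def QVec.phase (a : ℕ) (ψ : QVec) : QVec :=
  ψ.sum fun q z =>
    Finsupp.single q (if q a = 1 then Complex.exp (Complex.I * (Real.pi / 4 : ℝ)) * z else z)

/-- A state of the machine: classical memory, quantum memory, elapsed time.  The squared norm of
`qmem` is the probability of the sequence of measurement outcomes that led to the state. -/
structure State where
  cmem : ℕ → ℕ
  qmem : QVec
  time : ℕ

/-- Programs.  `assign a e` writes the value of `e` to the classical cell `a`; `xor a e`,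
`hadamard a`, `phase a` act on the quantum cell `a`; `measure d a` measures the quantum cell `a` and
writes the outcome to the classical cell `d`; `loop e P` executes `P` as many times as the value of
`e` on entry says. (Polynomial time programs need no other loops, since a time bound is known.) -/
inductive Prog
  | skip
  | assign (a e : CExpr)
  | xor (a : CExpr) (e : QExpr)
  | hadamard (a : CExpr)
  | phase (a : CExpr)
  | measure (d a : CExpr)
  | seq (P Q : Prog)
  | ite (e : CExpr) (P Q : Prog)
  | loop (e : CExpr) (P : Prog)

/-- Let time pass. -/
def State.tick (n : ℕ) (σ : State) : State := { σ with time := σ.time + n }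

/-- All the final states of a program, one for each possible sequence of measurement outcomes. A
gate on a superposition is charged its largest cost on a basis state of the superposition. -/
def Prog.exec : Prog → State → Multiset State
  | .skip, σ => {σ}
  | .assign a e, σ =>
      {{ σ with
          cmem := Function.update σ.cmem (a.eval σ.cmem) (e.eval σ.cmem)
          time := σ.time + (a.cost σ.cmem + e.cost σ.cmem + 1) }}
  | .xor a e, σ =>
      let b := a.eval σ.cmem
      {{ σ with
          qmem := σ.qmem.xor b (fun q => e.eval σ.cmem q)
          time := σ.time + (a.cost σ.cmem + 1 + σ.qmem.support.sup fun q =>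
            e.cost σ.cmem (q.erase b) + Nat.size (q b)) }}
  | .hadamard a, σ =>
      {{ σ with
          qmem := σ.qmem.hadamard (a.eval σ.cmem)
          time := σ.time + (a.cost σ.cmem + 1) }}
  | .phase a, σ =>
      {{ σ with
          qmem := σ.qmem.phase (a.eval σ.cmem)
          time := σ.time + (a.cost σ.cmem + 1) }}
  | .measure d a, σ =>
      (σ.qmem.support.image fun q => q (a.eval σ.cmem)).val.map fun v =>
        { cmem := Function.update σ.cmem (d.eval σ.cmem) v
          qmem := σ.qmem.filter fun q => q (a.eval σ.cmem) = v
          time := σ.time + (d.cost σ.cmem + a.cost σ.cmem + 1 + Nat.size v) }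
  | .seq P Q, σ => (P.exec σ).bind Q.exec
  | .ite e P Q, σ =>
      if e.eval σ.cmem ≠ 0 then P.exec (σ.tick (e.cost σ.cmem + 1))
      else Q.exec (σ.tick (e.cost σ.cmem + 1))
  | .loop e P, σ =>
      (fun S : Multiset State => S.bind fun τ => P.exec (τ.tick 1))^[e.eval σ.cmem]
        {σ.tick (e.cost σ.cmem + 1)}

/-- The probability that the classical cell `0` finally contains `v`. -/
def outProb (S : Multiset State) (v : ℕ) : ℝ :=
  (S.map fun σ => if σ.cmem 0 = v then σ.qmem.normSq else 0).sum

/-! ## The Gaussian extrapolated dihedral coset problem -/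

/-- The Gaussian function `ρ_r(j) = exp(-π j² / r²)`. -/
def rho (r : ℝ) (j : ℤ) : ℝ := Real.exp (-Real.pi * (j : ℝ) ^ 2 / r ^ 2)

/-- The amplitude of `|j⟩` in the normalized superposition `∑_{|j| ≤ B} ρ_r(j) |j⟩`. -/
def gaussAmp (r : ℝ) (B : ℕ) (j : ℤ) : ℝ :=
  rho r j / √(∑ i ∈ Finset.Icc (-(B : ℤ)) B, rho r i ^ 2)

/-- The basis state `⨂_k |j_k⟩ |y_k⟩` of the quantum memory: the cells `3k`, `3k+1`, `3k+2` contain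
the sign bit of `j_k` (which is `1` for `j_k < 0`), the absolute value of `j_k`, and `y_k`; all other
cells contain `0`. -/
def edcpBasis {N ℓ : ℕ} (j : Fin ℓ → ℤ) (y : Fin ℓ → ZMod N) : ℕ →₀ ℕ :=
  ∑ k : Fin ℓ, (Finsupp.single (3 * (k : ℕ)) (if j k < 0 then 1 else 0) +
    Finsupp.single (3 * (k : ℕ) + 1) (j k).natAbs +
    Finsupp.single (3 * (k : ℕ) + 2) (y k).val)

/-- The `ℓ` input states `∑_j ρ_r(j) |j⟩ |x_k + j s mod N⟩`, `k < ℓ`, of the Gaussian extrapolated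
dihedral coset problem with secret `s`; they are normalized, and `j` ranges over `[-B, B]`. -/
def gEDCPState {N ℓ : ℕ} (r : ℝ) (B : ℕ) (s : ZMod N) (x : Fin ℓ → ZMod N) : QVec :=
  ∑ j ∈ Fintype.piFinset fun _ : Fin ℓ => Finset.Icc (-(B : ℤ)) B,
    Finsupp.single (edcpBasis j fun k => x k + (j k : ZMod N) * s)
      ((∏ k, gaussAmp r B (j k) : ℝ) : ℂ)

/-! ## The dihedral coset problem -/

/-- The basis states `⨂_i |b_i⟩ |y_i⟩` of `ℓ` registers of the dihedral coset problem. -/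
abbrev DCPBasis (N ℓ : ℕ) : Type := Fin ℓ → Fin 2 × ZMod N

/-- The `ℓ` states `(|0⟩|x_i⟩ + |1⟩|x_i + s mod N⟩)/√2`, `i < ℓ`. -/
def dcpState {N ℓ : ℕ} (s : ZMod N) (x : Fin ℓ → ZMod N) (d : DCPBasis N ℓ) : ℂ :=
  ∏ i, if (d i).2 = x i + ((d i).1 : ℕ) * s then (((√2)⁻¹ : ℝ) : ℂ) else 0

open scoped ComplexOrder in
/-- A solver for `ℓ` registers of the dihedral coset problem: an arbitrary measurement whose
outcomes are elements of `ℤ/N` (it may also give no answer). -/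
structure DCPSolver (N ℓ : ℕ) [NeZero N] where
  effect : ZMod N → Matrix (DCPBasis N ℓ) (DCPBasis N ℓ) ℂ
  posSemidef : ∀ t, (effect t).PosSemidef
  sum_le_one : (1 - ∑ t, effect t).PosSemidef

open Matrix in
/-- The (unnormalized) probability of the answer `t` on the vector `φ`. -/
def DCPSolver.prob {N ℓ : ℕ} [NeZero N] (A : DCPSolver N ℓ) (t : ZMod N)
    (φ : DCPBasis N ℓ → ℂ) : ℝ :=
  (star φ ⬝ᵥ (A.effect t *ᵥ φ)).re

/-- The solver finds the secret with probability at least `p`, for every secret `s` and all shifts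
`x_i`. -/
def DCPSolver.SolvesWithProb {N ℓ : ℕ} [NeZero N] (A : DCPSolver N ℓ) (p : ℝ) : Prop :=
  ∀ (s : ZMod N) (x : Fin ℓ → ZMod N), p ≤ A.prob s (dcpState s x)

/-! ## Reductions -/

/-- The content of the quantum memory in which, from the address `b` on, `2ℓ` consecutive cells hold
the basis state `d` of `ℓ` dihedral coset registers; all other cells contain `0`. -/
def dcpCells {N ℓ : ℕ} (b : ℕ) (d : DCPBasis N ℓ) : ℕ →₀ ℕ :=
  ∑ i : Fin ℓ, (Finsupp.single (b + 2 * (i : ℕ)) ((d i).1 : ℕ) +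
    Finsupp.single (b + 2 * (i : ℕ) + 1) (d i).2.val)

/-- Set the cells `b, …, b + 2ℓ - 1` to `0`. -/
def clearCells (b ℓ : ℕ) (q : ℕ →₀ ℕ) : ℕ →₀ ℕ := q.filter fun a => ¬(b ≤ a ∧ a < b + 2 * ℓ)

/-- The (unnormalized) probability that the solver answers `t` when it is applied to the registers
that start at the address `b`, for the vector `ψ` of the whole quantum memory. The remaining cells
are traced out. Contents of the registers that are not dihedral coset basis states give no answer. -/
def DCPSolver.memProb {N ℓ : ℕ} [NeZero N] (A : DCPSolver N ℓ) (b : ℕ) (t : ZMod N) (ψ : QVec) : ℝ :=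
  ∑ z ∈ ψ.support.image (clearCells b ℓ), A.prob t fun d => ψ (z + dcpCells b d)

/-- The registers that start at the address `b` hold exactly `ℓ` dihedral coset states with secret
`s`, in tensor product with some vector `χ` of the remaining cells. -/
def HoldsDCP {N : ℕ} (ℓ b : ℕ) [NeZero N] (s : ZMod N) (ψ : QVec) : Prop :=
  ∃ (x : Fin ℓ → ZMod N) (χ : QVec), (∀ z ∈ χ.support, clearCells b ℓ z = z) ∧
    ψ = ∑ d : DCPBasis N ℓ, dcpState s x d • χ.mapDomain fun z => z + dcpCells b d

/-- The initial state of a reduction from `ℓ` Gaussian states to `ℓ'` dihedral coset states: the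
classical cells `1`, `2`, `3`, `4` contain `N`, `ℓ`, `ℓ'`, `κ`, and the quantum memory contains the
given Gaussian states. -/
def initState (κ N ℓ ℓ' : ℕ) (ψ : QVec) : State where
  cmem a := if a = 1 then N else if a = 2 then ℓ else if a = 3 then ℓ' else if a = 4 then κ else 0
  qmem := ψ
  time := 0

/-- The state after the solver has returned `t`: the answer is in the classical cell `0`, the
quantum memory is consumed. -/
def answerState {N : ℕ} (t : ZMod N) (σ : State) : State where
  cmem := Function.update σ.cmem 0 t.val
  qmem := Finsupp.single 0 1
  time := σ.time

/-- The probability that the secret `s` is found by the following procedure: run `pre`, apply the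
solver to the `ℓ'` registers that start at the address `3ℓ` (just behind the input), run `post`. -/
def successProb {N ℓ' : ℕ} [NeZero N] (pre post : Prog) (A : DCPSolver N ℓ') (κ ℓ : ℕ) (ψ : QVec)
    (s : ZMod N) : ℝ :=
  ((pre.exec (initState κ N ℓ ℓ' ψ)).map fun σ =>
    ∑ t : ZMod N, A.memProb (3 * ℓ) t σ.qmem * outProb (post.exec (answerState t σ)) s.val).sum

/-- The procedure with the given input takes at most `T` steps, the call of the solver being free. -/
def RunsInTime (pre post : Prog) (κ N ℓ ℓ' : ℕ) (ψ : QVec) (T : ℕ) : Prop :=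
  ∀ σ ∈ pre.exec (initState κ N ℓ ℓ' ψ), σ.time ≤ T ∧
    ∀ t : ZMod N, ∀ τ ∈ post.exec (answerState t σ), τ.time ≤ T

open Classical in
/-- The probability that `pre` ends with `ℓ'` dihedral coset states with secret `s` in the registers
that start at the address `3ℓ`. -/
def dcpOutputProb {N : ℕ} [NeZero N] (pre : Prog) (κ ℓ ℓ' : ℕ) (ψ : QVec) (s : ZMod N) : ℝ :=
  ((pre.exec (initState κ N ℓ ℓ' ψ)).map fun σ =>
    if HoldsDCP ℓ' (3 * ℓ) s σ.qmem then σ.qmem.normSq else 0).sum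

end CosetReduction

end

noncomputable section

namespace CosetReduction

/-! Measuring the absolute value of a Gaussian register with outcome `v ≠ 0` leaves only `j = v` and
`j = -v`, with equal amplitudes because the Gaussian is even: the register becomes an equal
superposition of `|+⟩|x + vs⟩` and `|-⟩|x - vs⟩`. If `v` is prime to `N` with inverse `u`,
multiplication by `u` turns the second components into `ux + s` and `ux - s`. With the sign bit
flipped this is a dihedral coset state with shift `ux - s` and secret `2s`. The extended Euclidean
algorithm decides coprimality and finds `u`. A correct answer `2s` of the solver has one half modulo
an odd `N` and two halves modulo an even `N`; in the second case a coin is tossed, which costs the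
factor `1/2`.

It remains to count. A register succeeds with a probability `P = coprimeProb N r B` that depends
neither on its shift nor on earlier outcomes. The number `1` alone gives `P ≥ c / r`
(`coprimeProb_ge_div`). If `r ≥ 3 ln N`, Chebyshev's bound `θ(r) ≥ r / 2` for large `r` is used: the
primes dividing `N` contribute at most `ln N ≤ r / 3` to `θ(r)`, so at least `(r / 6) / ln r` primes
up to `r` are prime to `N`. Each has squared weight at least `exp(-2π)`, while the total weight is
`O(1 + r)`, so `P ≥ c / log r` (`coprimeProb_ge_div_log`). In both regimes `P ℓ ≥ 4 ℓ' κ`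
(`exists_const`), and a Chernoff bound makes fewer than `ℓ'` successes exponentially unlikely in `κ`
(`failure_le`). The generating function `E[z ^ successes] = (1 - P + zP) ^ ℓ` needed for it is
carried through the loop by `LoopInv.sum_step`.

Two devices connect this with the machine. Vectors of the quantum memory are multiplied in a
commutative monoid algebra, so that tensor factors on disjoint cells can be rearranged by `ring`,
and gates and measurements act on a single factor (`xor_mul`, `Poly.filter_mul`). All cells stay
below `2 ^ n` with `n = κ + ℓ + |N| + |B|`, so that a single instruction costs at most a constant
times `n + 1`. -/

/-! ## Time bounds for programs -/

/-- A constant factor for the bit lengths and the cost of a classical expression. -/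
def CExpr.weight : CExpr → ℕ
  | .lit n => 1 + Nat.size n
  | .get a => a.weight + 2
  | .size a => 2 * a.weight + 1
  | .op _ a b => 2 * (a.weight + b.weight) + 2

/-- A constant factor for the bit lengths and the cost of a quantum expression. -/
def QExpr.weight : QExpr → ℕ
  | .ofC a => a.weight
  | .get a => a.weight + 2
  | .op _ a b => 2 * (a.weight + b.weight) + 2

/-- A constant factor for the time of a program whose loops are short. -/
def Prog.weight : Prog → ℕ
  | .skip => 0
  | .assign a e => a.weight + e.weight + 1
  | .xor a e => a.weight + 1 + (e.weight + 1)
  | .hadamard a => a.weight + 1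
  | .phase a => a.weight + 1
  | .measure d a => d.weight + a.weight + 1 + 1
  | .seq P Q => P.weight + Q.weight
  | .ite e P Q => e.weight + 1 + (P.weight + Q.weight)
  | .loop e P => e.weight + 1 + 3 * (P.weight + 1)

/-- Bit lengths add under multiplication, and the `+ 1` is the carry of an addition. The other
operations never exceed their first operand. -/
theorem ArithOp.size_eval_le (o : ArithOp) (x y : ℕ) :
    Nat.size (o.eval x y) ≤ Nat.size x + Nat.size y + 1 := by
  have hx := Nat.lt_size_self x
  have hy := Nat.lt_size_self y
  have h1 : 2 ^ Nat.size x ≤ 2 ^ (Nat.size x + Nat.size y) :=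
    Nat.pow_le_pow_right (by norm_num) (by omega)
  have h2 : 2 ^ Nat.size y ≤ 2 ^ (Nat.size x + Nat.size y) :=
    Nat.pow_le_pow_right (by norm_num) (by omega)
  have h3 : x * y < 2 ^ (Nat.size x + Nat.size y) := by
    rw [pow_add]
    exact Nat.mul_lt_mul'' hx hy
  rw [Nat.size_le, pow_succ]
  have h4 := Nat.div_le_self x y
  have h5 := Nat.mod_le x y
  cases o <;> simp only [ArithOp.eval] <;> omega

/-- Size and cost go through one induction because the cost of a node includes the size of its
value, which is bounded through the sizes of the operands. Hence the factor `2` in `weight`. -/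
theorem CExpr.bound {c : ℕ → ℕ} {n : ℕ} (hc : ∀ a, c a < 2 ^ n) (e : CExpr) :
    Nat.size (e.eval c) ≤ e.weight * (n + 1) ∧ e.cost c ≤ e.weight * (n + 1) := by
  have hs : ∀ a, Nat.size (c a) ≤ n := fun a => Nat.size_le.2 (hc a)
  induction e with
  | lit m => simp only [CExpr.eval, CExpr.cost, CExpr.weight]; constructor <;> nlinarith
  | get a iha =>
    simp only [CExpr.eval, CExpr.cost, CExpr.weight, add_mul]
    have := hs (a.eval c)
    omega
  | size a iha =>
    simp only [CExpr.eval, CExpr.cost, CExpr.weight, add_mul, mul_assoc 2]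
    have : Nat.size (Nat.size (a.eval c)) ≤ Nat.size (a.eval c) :=
      Nat.size_le.2 Nat.lt_two_pow_self
    omega
  | op o a b iha ihb =>
    simp only [CExpr.eval, CExpr.cost, CExpr.weight, add_mul, mul_assoc 2]
    have := o.size_eval_le (a.eval c) (b.eval c)
    omega

theorem CExpr.cost_le {c : ℕ → ℕ} {n : ℕ} (hc : ∀ a, c a < 2 ^ n) (e : CExpr) {M : ℕ}
    (hM : n + 1 ≤ M) : e.cost c ≤ e.weight * M :=
  (CExpr.bound hc e).2.trans (Nat.mul_le_mul_left _ hM)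

theorem QExpr.bound {c : ℕ → ℕ} {q : ℕ →₀ ℕ} {n : ℕ} (hc : ∀ a, c a < 2 ^ n)
    (hq : ∀ a, q a < 2 ^ n) (e : QExpr) :
    Nat.size (e.eval c q) ≤ e.weight * (n + 1) ∧ e.cost c q ≤ e.weight * (n + 1) := by
  have hs : ∀ a, Nat.size (q a) ≤ n := fun a => Nat.size_le.2 (hq a)
  induction e with
  | ofC a => exact a.bound hc
  | get a =>
    simp only [QExpr.eval, QExpr.cost, QExpr.weight, add_mul]
    have := hs (a.eval c)
    have := a.bound hc
    omega
  | op o a b iha ihb =>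
    simp only [QExpr.eval, QExpr.cost, QExpr.weight, add_mul, mul_assoc 2]
    have := o.size_eval_le (a.eval c q) (b.eval c q)
    omega

/-- The program `P` changes the classical memory `c` to `c'` and the quantum memory `φ` to `φ'` in
time at most `K * M`, without branching. -/
def Runs (M K : ℕ) (P : Prog) (c : ℕ → ℕ) (φ : QVec) (c' : ℕ → ℕ) (φ' : QVec) : Prop :=
  ∀ T, ∃ T', T' ≤ T + K * M ∧ P.exec ⟨c, φ, T⟩ = {⟨c', φ', T'⟩}

theorem Runs.mono {M M' K K' : ℕ} {P : Prog} {c c' : ℕ → ℕ} {φ φ' : QVec}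
    (h : Runs M K P c φ c' φ') (hM : M ≤ M') (hK : K ≤ K') : Runs M' K' P c φ c' φ' := by
  intro T
  obtain ⟨T', h1, h2⟩ := h T
  exact ⟨T', h1.trans (Nat.add_le_add_left (Nat.mul_le_mul hK hM) _), h2⟩

theorem Runs.skip (M : ℕ) (c : ℕ → ℕ) (φ : QVec) : Runs M Prog.skip.weight .skip c φ c φ :=
  fun T => ⟨T, Nat.le_add_right _ _, rfl⟩

theorem Runs.seq {M : ℕ} {P Q : Prog} {c c₁ c₂ : ℕ → ℕ} {φ φ₁ φ₂ : QVec}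
    (h₁ : Runs M P.weight P c φ c₁ φ₁) (h₂ : Runs M Q.weight Q c₁ φ₁ c₂ φ₂) :
    Runs M (P.seq Q).weight (P.seq Q) c φ c₂ φ₂ := by
  intro T
  obtain ⟨T₁, hT₁, e₁⟩ := h₁ T
  obtain ⟨T₂, hT₂, e₂⟩ := h₂ T₁
  refine ⟨T₂, ?_, by simp [Prog.exec, e₁, e₂]⟩
  simp only [Prog.weight]
  linarith [add_mul P.weight Q.weight M]

theorem Runs.assign {n M : ℕ} {c : ℕ → ℕ} (hc : ∀ a, c a < 2 ^ n) (hM : n + 1 ≤ M)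
    (a e : CExpr) (φ : QVec) :
    Runs M (Prog.assign a e).weight (.assign a e) c φ
      (Function.update c (a.eval c) (e.eval c)) φ := by
  intro T
  refine ⟨_, ?_, rfl⟩
  have h1 := a.cost_le hc hM
  have h2 := e.cost_le hc hM
  simp only [Prog.weight]
  nlinarith

theorem Runs.xor {n M : ℕ} {c : ℕ → ℕ} {φ : QVec} (hc : ∀ a, c a < 2 ^ n)
    (hφ : ∀ q ∈ φ.support, ∀ a, q a < 2 ^ n) (hM : n + 1 ≤ M) (a : CExpr) (e : QExpr) :
    Runs M (Prog.xor a e).weight (.xor a e) c φ c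
      (φ.xor (a.eval c) fun q => e.eval c q) := by
  intro T
  refine ⟨_, ?_, rfl⟩
  have h1 := a.cost_le hc hM
  have h2 : (φ.support.sup fun q =>
      e.cost c (q.erase (a.eval c)) + Nat.size (q (a.eval c))) ≤ (e.weight + 1) * M := by
    refine Finset.sup_le fun q hq => ?_
    have hq' : ∀ b, (q.erase (a.eval c)) b < 2 ^ n := by
      intro b
      rw [Finsupp.erase_apply]
      split_ifs
      · positivity
      · exact hφ q hq b
    have h3 := (e.bound hc hq').2
    have h4 : Nat.size (q (a.eval c)) ≤ n := Nat.size_le.2 (hφ q hq _)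
    calc _ ≤ e.weight * (n + 1) + n := Nat.add_le_add h3 h4
      _ ≤ (e.weight + 1) * (n + 1) := by nlinarith
      _ ≤ _ := Nat.mul_le_mul_left _ hM
  simp only [Prog.weight]
  nlinarith

theorem Runs.ite_pos {n M : ℕ} {e : CExpr} {P Q : Prog} {c c' : ℕ → ℕ} {φ φ' : QVec}
    (hc : ∀ a, c a < 2 ^ n) (hM : n + 1 ≤ M) (he : e.eval c ≠ 0)
    (h : Runs M P.weight P c φ c' φ') : Runs M (Prog.ite e P Q).weight (.ite e P Q) c φ c' φ' := by
  intro T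
  obtain ⟨T', hT, e'⟩ := h (T + (e.cost c + 1))
  refine ⟨T', ?_, by simpa [Prog.exec, he, State.tick] using e'⟩
  have h1 := e.cost_le hc hM
  simp only [Prog.weight]
  nlinarith

theorem Runs.ite_neg {n M : ℕ} {e : CExpr} {P Q : Prog} {c c' : ℕ → ℕ} {φ φ' : QVec}
    (hc : ∀ a, c a < 2 ^ n) (hM : n + 1 ≤ M) (he : e.eval c = 0)
    (h : Runs M Q.weight Q c φ c' φ') : Runs M (Prog.ite e P Q).weight (.ite e P Q) c φ c' φ' := by
  intro T
  obtain ⟨T', hT, e'⟩ := h (T + (e.cost c + 1))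
  refine ⟨T', ?_, by simpa [Prog.exec, he, State.tick] using e'⟩
  have h1 := e.cost_le hc hM
  simp only [Prog.weight]
  nlinarith

/-- The invariant rule for a purely classical loop without branching, used for the Euclidean
algorithm. Its `2 * Nat.size N` iterations fit into `3 * (n + 1)`, so the time budget grows by a
factor `n + 1`. -/
theorem Runs.loop {n M m : ℕ} {e : CExpr} {P : Prog} {c : ℕ → ℕ} {φ : QVec}
    (hc : ∀ a, c a < 2 ^ n) (hM : n + 1 ≤ M) (he : e.eval c = m) (hm : m ≤ 3 * (n + 1))
    (I : ℕ → (ℕ → ℕ) → Prop) (h0 : I 0 c)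
    (h : ∀ i < m, ∀ c, I i c → ∃ c', I (i + 1) c' ∧ Runs M P.weight P c φ c' φ) :
    ∃ c', I m c' ∧ Runs (M * (n + 1)) (Prog.loop e P).weight (.loop e P) c φ c' φ := by
  have key : ∀ i ≤ m, ∃ c', I i c' ∧ ∀ T, ∃ T', T' ≤ T + i * (P.weight * M + 1) ∧
      (fun S : Multiset State => S.bind fun τ => P.exec (τ.tick 1))^[i] {⟨c, φ, T⟩} =
        {⟨c', φ, T'⟩} := by
    intro i hi
    induction i with
    | zero => exact ⟨c, h0, fun T => ⟨T, by simp, rfl⟩⟩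
    | succ i ih =>
      obtain ⟨c₁, hI, h₁⟩ := ih (by omega)
      obtain ⟨c₂, hI₂, h₂⟩ := h i (by omega) c₁ hI
      refine ⟨c₂, hI₂, fun T => ?_⟩
      obtain ⟨T₁, hT₁, e₁⟩ := h₁ T
      obtain ⟨T₂, hT₂, e₂⟩ := h₂ (T₁ + 1)
      refine ⟨T₂, by nlinarith, ?_⟩
      rw [Function.iterate_succ_apply', e₁]
      simpa [State.tick] using e₂
  obtain ⟨c', hI, hr⟩ := key m le_rfl
  refine ⟨c', hI, fun T => ?_⟩
  obtain ⟨T', hT', e'⟩ := hr (T + (e.cost c + 1))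
  refine ⟨T', hT'.trans ?_, by simpa [Prog.exec, he, State.tick] using e'⟩
  have h1 := e.cost_le hc hM
  simp only [Prog.weight]
  have h2 : m * (P.weight * M + 1) ≤ 3 * (n + 1) * ((P.weight + 1) * M) :=
    Nat.mul_le_mul hm (by nlinarith)
  have h3 : e.weight * M + 1 ≤ (e.weight + 1) * (M * (n + 1)) := by
    have : M ≤ M * (n + 1) := Nat.le_mul_of_pos_right _ (by omega)
    calc e.weight * M + 1 ≤ (e.weight + 1) * M := by nlinarith
      _ ≤ _ := Nat.mul_le_mul_left _ this
  calc _ ≤ T + (e.weight * M + 1) + 3 * (n + 1) * ((P.weight + 1) * M) := by omega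
    _ ≤ T + (e.weight + 1) * (M * (n + 1)) + 3 * (n + 1) * ((P.weight + 1) * M) := by omega
    _ = _ := by ring

/-! ## Classical memories with finitely many cells in use -/

/-- The classical memory with the given contents of the first cells. -/
def mem (l : List ℕ) (a : ℕ) : ℕ := l.getD a 0

theorem update_mem {l : List ℕ} {i : ℕ} (hi : i < l.length) (v : ℕ) :
    Function.update (mem l) i v = mem (l.set i v) := by
  funext a
  by_cases h : a = i
  · subst h
    simp [mem, hi]
  · simp [mem, h, Ne.symm h]

theorem forall_mem_nil_iff {p : ℕ → Prop} : (∀ x ∈ ([] : List ℕ), p x) ↔ True := by simp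

theorem mem_lt {l : List ℕ} {n : ℕ} (h : ∀ x ∈ l, x < 2 ^ n) (a : ℕ) : mem l a < 2 ^ n := by
  by_cases ha : a < l.length
  · simpa [mem, ha] using h _ (List.getElem_mem ha)
  · simp [mem, ha]

theorem Runs.assign_mem {n M i v : ℕ} {l l' : List ℕ} (hl : ∀ x ∈ l, x < 2 ^ n) (hM : n + 1 ≤ M)
    (hi : i < l.length) {e : CExpr} (he : e.eval (mem l) = v) (hl' : l.set i v = l') (φ : QVec) :
    Runs M (Prog.assign (.lit i) e).weight (.assign (.lit i) e) (mem l) φ (mem l') φ := by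
  convert Runs.assign (mem_lt hl) hM (.lit i) e φ using 1
  rw [← hl', he]
  exact (update_mem hi v).symm

/-! ## The programs -/

/-- The content of the classical cell `i`. -/
abbrev cell (i : ℕ) : CExpr := .get (.lit i)

/-- One step of the extended Euclidean algorithm modulo the content of cell `1`, on the remainders
in the cells `8`, `9` and their coefficients in the cells `10`, `11`. -/
def euclidStep : Prog :=
  .ite (cell 9)
    (.seq (.assign (.lit 12) (.op .mod (cell 8) (cell 9)))
    -- Since subtraction is truncated, `-t₁` is represented by `N - t₁` modulo `N`.
    (.seq (.assign (.lit 13) (.op .mod (.op .add (cell 10)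
      (.op .mul (.op .div (cell 8) (cell 9)) (.op .sub (cell 1) (cell 11)))) (cell 1)))
    (.seq (.assign (.lit 8) (cell 9))
    (.seq (.assign (.lit 9) (cell 12))
    (.seq (.assign (.lit 10) (cell 11))
    (.assign (.lit 11) (cell 13)))))))
    .skip

/-- The extended Euclidean algorithm for the contents of the cells `1` and `7`. -/
def euclid : Prog :=
  .seq (.assign (.lit 8) (cell 1))
  (.seq (.assign (.lit 9) (.op .mod (cell 7) (cell 1)))
  (.seq (.assign (.lit 10) (.lit 0))
  (.seq (.assign (.lit 11) (.lit 1))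
  -- The product of the two remainders is at most `N * N` initially and at least halves in every
  -- step, so twice the bit length of `N` is enough.
  (.loop (.op .mul (.lit 2) (.size (cell 1))) euclidStep))))

/-- The address of the sign bit of the register whose number is in cell `5`. -/
def srcAddr : CExpr := .op .mul (.lit 3) (cell 5)

/-- The address of the dihedral coset register whose number is in cell `6`. -/
def dstAddr : CExpr := .op .add (.op .mul (.lit 3) (cell 2)) (.op .mul (.lit 2) (cell 6))

/-- Turn the measured register into a dihedral coset state and move it to the output. -/
def moveRegister : Prog :=
  -- The bit is the negated sign, so that the branch `ux - s` gets `0` and the branch `ux + s` gets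
  -- `1`. The next gate erases the sign, which can be recomputed from this bit.
  .seq (.xor dstAddr (.op .sub (.ofC (.lit 1)) (.get srcAddr)))
  (.seq (.xor srcAddr (.op .sub (.ofC (.lit 1)) (.get dstAddr)))
  (.seq (.xor (.op .add dstAddr (.lit 1))
    (.op .mod (.op .mul (.ofC (cell 10)) (.get (.op .add srcAddr (.lit 2)))) (.ofC (cell 1))))
  -- The old value is `v` times the new one modulo `N`, so this gate erases it and disentangles the
  -- source register.
  (.seq (.xor (.op .add srcAddr (.lit 2))
    (.op .mod (.op .mul (.ofC (cell 7)) (.get (.op .add dstAddr (.lit 1)))) (.ofC (cell 1))))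
  (.assign (.lit 6) (.op .add (cell 6) (.lit 1))))))

/-- The treatment of a register after the measurement of its absolute value. -/
def processRegister : Prog :=
  .seq euclid
  -- Cell `8` holds a positive gcd, so the truncated difference is `0` exactly when the gcd is `1`.
  (.seq (.ite (.op .sub (cell 8) (.lit 1)) .skip moveRegister)
  (.assign (.lit 5) (.op .add (cell 5) (.lit 1))))

/-- The treatment of a register. -/
def registerStep : Prog :=
  .seq (.measure (.lit 7) (.op .add srcAddr (.lit 1))) processRegister

/-- The reduction before the call of the solver. -/
def preProg : Prog := .loop (cell 2) registerStep

/-- The reduction after the call of the solver: a random solution `s` of `2s = t`. -/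
def postProg : Prog :=
  .ite (.op .mod (cell 1) (.lit 2))
    (.assign (.lit 0) (.op .mod
      (.op .mul (cell 0) (.op .div (.op .add (cell 1) (.lit 1)) (.lit 2))) (cell 1)))
    -- After the call of the solver the quantum memory is in the zero state, so this gate and the
    -- measurement toss a fair coin.
    (.seq (.hadamard (.lit 0))
    (.seq (.measure (.lit 12) (.lit 0))
    (.assign (.lit 0) (.op .mod (.op .add (.op .div (cell 0) (.lit 2))
      (.op .mul (cell 12) (.op .div (cell 1) (.lit 2)))) (cell 1)))))

/-! ## The deterministic parts -/

theorem euclidStep_runs {n z N ℓ ℓ' κ k m v r₀ r₁ t₀ t₁ x y : ℕ} (hr₁ : r₁ ≠ 0) (hN : 0 < N)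
    (h : ∀ a ∈ [z, N, ℓ, ℓ', κ, k, m, v, r₀, r₁, t₀, t₁, x, y], a < 2 ^ n) (φ : QVec) :
    Runs (n + 1) euclidStep.weight euclidStep
      (mem [z, N, ℓ, ℓ', κ, k, m, v, r₀, r₁, t₀, t₁, x, y]) φ
      (mem [z, N, ℓ, ℓ', κ, k, m, v, r₁, r₀ % r₁, t₁, (t₀ + r₀ / r₁ * (N - t₁)) % N,
        r₀ % r₁, (t₀ + r₀ / r₁ * (N - t₁)) % N]) φ := by
  simp only [List.mem_cons, List.not_mem_nil, or_false, forall_eq_or_imp, forall_eq] at h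
  have h1 : r₀ % r₁ < 2 ^ n := (Nat.mod_le _ _).trans_lt (by omega)
  have h2 : (t₀ + r₀ / r₁ * (N - t₁)) % N < 2 ^ n := (Nat.mod_lt _ hN).trans (by omega)
  refine Runs.ite_pos
    (mem_lt (by simp only [List.forall_mem_cons, forall_mem_nil_iff, and_true]; omega))
    le_rfl hr₁ ?_
  refine Runs.seq (c₁ := mem [z, N, ℓ, ℓ', κ, k, m, v, r₀, r₁, t₀, t₁, r₀ % r₁, y]) (φ₁ := φ) ?_ ?_
  · exact Runs.assign_mem (by simp only [List.forall_mem_cons, forall_mem_nil_iff, and_true]; omega)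
      le_rfl (by simp) rfl rfl _
  refine Runs.seq (c₁ := mem [z, N, ℓ, ℓ', κ, k, m, v, r₀, r₁, t₀, t₁, r₀ % r₁,
    (t₀ + r₀ / r₁ * (N - t₁)) % N]) (φ₁ := φ) ?_ ?_
  · exact Runs.assign_mem (by simp only [List.forall_mem_cons, forall_mem_nil_iff, and_true]; omega)
      le_rfl (by simp) rfl rfl _
  refine Runs.seq (c₁ := mem [z, N, ℓ, ℓ', κ, k, m, v, r₁, r₁, t₀, t₁, r₀ % r₁,
    (t₀ + r₀ / r₁ * (N - t₁)) % N]) (φ₁ := φ) ?_ ?_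
  · exact Runs.assign_mem (by simp only [List.forall_mem_cons, forall_mem_nil_iff, and_true]; omega)
      le_rfl (by simp) rfl rfl _
  refine Runs.seq (c₁ := mem [z, N, ℓ, ℓ', κ, k, m, v, r₁, r₀ % r₁, t₀, t₁, r₀ % r₁,
    (t₀ + r₀ / r₁ * (N - t₁)) % N]) (φ₁ := φ) ?_ ?_
  · exact Runs.assign_mem (by simp only [List.forall_mem_cons, forall_mem_nil_iff, and_true]; omega)
      le_rfl (by simp) rfl rfl _
  refine Runs.seq (c₁ := mem [z, N, ℓ, ℓ', κ, k, m, v, r₁, r₀ % r₁, t₁, t₁, r₀ % r₁,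
    (t₀ + r₀ / r₁ * (N - t₁)) % N]) (φ₁ := φ) ?_ ?_
  · exact Runs.assign_mem (by simp only [List.forall_mem_cons, forall_mem_nil_iff, and_true]; omega)
      le_rfl (by simp) rfl rfl _
  · exact Runs.assign_mem (by simp only [List.forall_mem_cons, forall_mem_nil_iff, and_true]; omega)
      le_rfl (by simp) rfl rfl _

/-- The invariant of the extended Euclidean algorithm. -/
structure EuclidInv (N v i r₀ r₁ t₀ t₁ : ℕ) : Prop where
  le : r₀ ≤ N
  lt : r₁ < r₀
  gcd : Nat.gcd r₀ r₁ = Nat.gcd v N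
  lt₀ : t₀ < N
  lt₁ : t₁ < N
  eq₀ : (t₀ * v : ZMod N) = r₀
  eq₁ : (t₁ * v : ZMod N) = r₁
  -- The potential that forces termination after `2 * Nat.size N` steps.
  size : r₀ * r₁ * 2 ^ i ≤ N * N

theorem EuclidInv.init {N : ℕ} (hN : 2 ≤ N) (v : ℕ) : EuclidInv N v 0 N (v % N) 0 1 where
  le := le_rfl
  lt := Nat.mod_lt _ (by omega)
  gcd := by rw [Nat.gcd_comm, ← Nat.gcd_rec, Nat.gcd_comm]
  lt₀ := by omega
  lt₁ := by omega
  eq₀ := by simp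
  eq₁ := by simp
  size := by simpa using Nat.mul_le_mul_left N (Nat.mod_lt v (by omega : N > 0)).le

/-- The potential halves because `r₁ < r₀` makes the quotient at least `1`, whence `r₀ ≥ r₁ + r₀ %
r₁ ≥ 2 * (r₀ % r₁)`. -/
theorem EuclidInv.step {N v i r₀ r₁ t₀ t₁ : ℕ} (h : EuclidInv N v i r₀ r₁ t₀ t₁) (hr : r₁ ≠ 0) :
    EuclidInv N v (i + 1) r₁ (r₀ % r₁) t₁ ((t₀ + r₀ / r₁ * (N - t₁)) % N) where
  le := h.lt.le.trans h.le
  lt := Nat.mod_lt _ (by omega)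
  gcd := by rw [← h.gcd, Nat.gcd_comm r₁, ← Nat.gcd_rec, Nat.gcd_comm]
  lt₀ := h.lt₁
  lt₁ := Nat.mod_lt _ (by have := h.lt₁; omega)
  eq₀ := h.eq₁
  eq₁ := by
    have e : ((r₀ : ℕ) : ZMod N) = r₁ * (r₀ / r₁ : ℕ) + (r₀ % r₁ : ℕ) := by
      exact_mod_cast congrArg (Nat.cast : ℕ → ZMod N) (Nat.div_add_mod r₀ r₁).symm
    rw [ZMod.natCast_mod]
    push_cast [h.lt₁.le]
    rw [CharP.cast_eq_zero (ZMod N) N]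
    linear_combination h.eq₀ - (r₀ / r₁ : ℕ) * h.eq₁ + e
  size := by
    have h1 : r₀ % r₁ + r₁ ≤ r₀ := by
      have := Nat.div_add_mod r₀ r₁
      have h2 : 1 ≤ r₀ / r₁ := Nat.div_pos h.lt.le (by omega)
      nlinarith
    have h2 : r₀ % r₁ < r₁ := Nat.mod_lt _ (by omega)
    calc r₁ * (r₀ % r₁) * 2 ^ (i + 1) = (r₁ * (2 * (r₀ % r₁))) * 2 ^ i := by ring
      _ ≤ (r₁ * r₀) * 2 ^ i := by gcongr; omega
      _ ≤ N * N := by rw [mul_comm r₁]; exact h.size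

theorem EuclidInv.eq_zero {N v r₀ r₁ t₀ t₁ : ℕ}
    (h : EuclidInv N v (2 * Nat.size N) r₀ r₁ t₀ t₁) : r₁ = 0 := by
  have h1 := h.size
  have h2 := Nat.lt_size_self N
  have h3 : r₀ * r₁ * 2 ^ (2 * Nat.size N) < 1 * 2 ^ (2 * Nat.size N) := by
    refine h1.trans_lt ?_
    rw [one_mul, two_mul, pow_add]
    exact Nat.mul_lt_mul'' h2 h2
  have h4 := Nat.lt_of_mul_lt_mul_right h3
  have h5 := h.lt
  rcases Nat.mul_eq_zero.1 (by omega : r₀ * r₁ = 0) with h | h <;> omega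

theorem euclid_runs {n z N ℓ ℓ' κ k m v r₀ r₁ t₀ t₁ x y : ℕ} (hN : 2 ≤ N)
    (h : ∀ a ∈ [z, N, ℓ, ℓ', κ, k, m, v, r₀, r₁, t₀, t₁, x, y], a < 2 ^ n) (φ : QVec) :
    ∃ t t' x' y' : ℕ, (t * v : ZMod N) = (Nat.gcd v N : ℕ) ∧
      (∀ a ∈ [z, N, ℓ, ℓ', κ, k, m, v, Nat.gcd v N, 0, t, t', x', y'], a < 2 ^ n) ∧
      Runs ((n + 1) * (n + 1)) euclid.weight euclid
        (mem [z, N, ℓ, ℓ', κ, k, m, v, r₀, r₁, t₀, t₁, x, y]) φ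
        (mem [z, N, ℓ, ℓ', κ, k, m, v, Nat.gcd v N, 0, t, t', x', y']) φ := by
  simp only [List.mem_cons, List.not_mem_nil, or_false, forall_eq_or_imp, forall_eq] at h
  have hM : n + 1 ≤ (n + 1) * (n + 1) := Nat.le_mul_of_pos_left _ (by omega)
  have hv : v % N < 2 ^ n := (Nat.mod_le _ _).trans_lt (by omega)
  obtain ⟨c', ⟨r₀', r₁', t₀', t₁', x', y', rfl, hb, hI⟩, hr⟩ :=
    Runs.loop (n := n) (M := n + 1) (m := 2 * Nat.size N)
      (e := .op .mul (.lit 2) (.size (cell 1))) (P := euclidStep)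
      (c := mem [z, N, ℓ, ℓ', κ, k, m, v, N, v % N, 0, 1, x, y]) (φ := φ)
      (mem_lt (by simp only [List.forall_mem_cons, forall_mem_nil_iff, and_true]; omega)) le_rfl rfl
      (by have : Nat.size N ≤ n := Nat.size_le.2 h.2.1
          omega)
      (fun i c => ∃ r₀ r₁ t₀ t₁ x y, c = mem [z, N, ℓ, ℓ', κ, k, m, v, r₀, r₁, t₀, t₁, x, y] ∧
        (∀ a ∈ [z, N, ℓ, ℓ', κ, k, m, v, r₀, r₁, t₀, t₁, x, y], a < 2 ^ n) ∧
        EuclidInv N v i r₀ r₁ t₀ t₁)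
      ⟨_, _, _, _, _, _, rfl,
        by simp only [List.forall_mem_cons, forall_mem_nil_iff, and_true]; omega,
        EuclidInv.init hN v⟩
      (by
        rintro i - c ⟨r₀, r₁, t₀, t₁, x, y, rfl, hb, hI⟩
        have hb' := hb
        simp only [List.mem_cons, List.not_mem_nil, or_false, forall_eq_or_imp, forall_eq] at hb'
        by_cases hr : r₁ = 0
        · subst hr
          -- After the remainder `0` the iterations are idle, and the potential is `0`, so the
          -- invariant persists for every later `i`.
          refine ⟨_, ⟨_, _, _, _, _, _, rfl, hb, { hI with size := by simp }⟩, ?_⟩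
          exact Runs.ite_neg (mem_lt hb) le_rfl rfl (Runs.skip _ _ _)
        · have h1 : r₀ % r₁ < 2 ^ n := (Nat.mod_le _ _).trans_lt (by omega)
          have h2 : (t₀ + r₀ / r₁ * (N - t₁)) % N < 2 ^ n :=
            (Nat.mod_lt _ (by omega)).trans (by omega)
          exact ⟨_, ⟨_, _, _, _, _, _, rfl,
            by simp only [List.forall_mem_cons, forall_mem_nil_iff, and_true]; omega,
            hI.step hr⟩,
            euclidStep_runs hr (by omega) hb φ⟩)
  obtain rfl := hI.eq_zero
  have hg : r₀' = Nat.gcd v N := by simpa using hI.gcd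
  subst hg
  refine ⟨t₀', t₁', x', y', hI.eq₀, hb, ?_⟩
  refine Runs.seq (c₁ := mem [z, N, ℓ, ℓ', κ, k, m, v, N, r₁, t₀, t₁, x, y]) (φ₁ := φ) ?_ ?_
  · exact Runs.assign_mem (by simp only [List.forall_mem_cons, forall_mem_nil_iff, and_true]; omega)
      hM (by simp) rfl rfl _
  refine Runs.seq (c₁ := mem [z, N, ℓ, ℓ', κ, k, m, v, N, v % N, t₀, t₁, x, y]) (φ₁ := φ) ?_ ?_
  · exact Runs.assign_mem (by simp only [List.forall_mem_cons, forall_mem_nil_iff, and_true]; omega)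
      hM (by simp) rfl rfl _
  refine Runs.seq (c₁ := mem [z, N, ℓ, ℓ', κ, k, m, v, N, v % N, 0, t₁, x, y]) (φ₁ := φ) ?_ ?_
  · exact Runs.assign_mem (by simp only [List.forall_mem_cons, forall_mem_nil_iff, and_true]; omega)
      hM (by simp) rfl rfl _
  refine Runs.seq (c₁ := mem [z, N, ℓ, ℓ', κ, k, m, v, N, v % N, 0, 1, x, y]) (φ₁ := φ) ?_ hr
  exact Runs.assign_mem (by simp only [List.forall_mem_cons, forall_mem_nil_iff, and_true]; omega)
      hM (by simp) rfl rfl _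

/-- The effect of `moveRegister` on the quantum memory. -/
def moveState (N k A u v : ℕ) (φ : QVec) : QVec :=
  (((φ.xor A fun q => 1 - q (3 * k)).xor (3 * k) fun q => 1 - q A).xor (A + 1)
    fun q => u * q (3 * k + 2) % N).xor (3 * k + 2) fun q => v * q (A + 1) % N

/-- Bitwise xor does not increase the bit length, so the gates never enlarge the `n`-bit bound on
the cells. -/
theorem xor_support_lt {n a : ℕ} {f : (ℕ →₀ ℕ) → ℕ} {φ : QVec}
    (hφ : ∀ q ∈ φ.support, ∀ b, q b < 2 ^ n) (hf : ∀ q, f q < 2 ^ n) :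
    ∀ q ∈ (φ.xor a f).support, ∀ b, q b < 2 ^ n := by
  classical
  intro q hq b
  obtain ⟨p, hp, rfl⟩ := Finset.mem_image.1 (Finsupp.mapDomain_support hq)
  by_cases h : b = a
  · subst h
    simpa [xorBasis] using Nat.xor_lt_two_pow (hφ p hp b) (hf _)
  · simpa [xorBasis, Function.update_of_ne h] using hφ p hp b

theorem moveState_lt {n N k A u v : ℕ} {φ : QVec} (hN : 0 < N) (hN' : N < 2 ^ n)
    (hφ : ∀ q ∈ φ.support, ∀ b, q b < 2 ^ n) :
    ∀ q ∈ (moveState N k A u v φ).support, ∀ b, q b < 2 ^ n := by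
  refine xor_support_lt (xor_support_lt (xor_support_lt (xor_support_lt hφ ?_) ?_) ?_) ?_
  · intro q; omega
  · intro q; omega
  · exact fun q => (Nat.mod_lt _ hN).trans hN'
  · exact fun q => (Nat.mod_lt _ hN).trans hN'

theorem moveRegister_runs {n M z N ℓ ℓ' κ k m v r₀ r₁ u t₁ x y : ℕ} (hM : n + 1 ≤ M) (hN : 2 ≤ N)
    (h : ∀ a ∈ [z, N, ℓ, ℓ', κ, k, m, v, r₀, r₁, u, t₁, x, y], a < 2 ^ n) {φ : QVec}
    (hφ : ∀ q ∈ φ.support, ∀ b, q b < 2 ^ n) :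
    Runs M moveRegister.weight moveRegister
      (mem [z, N, ℓ, ℓ', κ, k, m, v, r₀, r₁, u, t₁, x, y]) φ
      (mem [z, N, ℓ, ℓ', κ, k, m + 1, v, r₀, r₁, u, t₁, x, y])
      (moveState N k (3 * ℓ + 2 * m) u v φ) := by
  have hc := mem_lt h
  have h0 := h
  simp only [List.mem_cons, List.not_mem_nil, or_false, forall_eq_or_imp, forall_eq] at h
  have h1 := xor_support_lt (a := 3 * ℓ + 2 * m) (f := fun q => 1 - q (3 * k)) hφ
    (fun q => by omega)
  have h2 := xor_support_lt (a := 3 * k) (f := fun q => 1 - q (3 * ℓ + 2 * m)) h1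
    (fun q => by omega)
  have h3 := xor_support_lt (a := 3 * ℓ + 2 * m + 1) (f := fun q => u * q (3 * k + 2) % N) h2
    (fun q => (Nat.mod_lt _ (by omega)).trans h.2.1)
  refine Runs.seq (Runs.xor hc hφ hM _ _) ?_
  refine Runs.seq (Runs.xor hc h1 hM _ _) ?_
  refine Runs.seq (Runs.xor hc h2 hM _ _) ?_
  refine Runs.seq (Runs.xor hc h3 hM _ _) ?_
  exact Runs.assign_mem h0 hM (by simp) rfl rfl _

/-- Once `v` has been measured everything is deterministic: the branch is chosen by `Nat.gcd v N`,
and in the coprime case the Euclidean coefficient `u` is the inverse of `v`. -/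
theorem processRegister_runs {n z N ℓ ℓ' κ k m v r₀ r₁ t₀ t₁ x y : ℕ} (hN : 2 ≤ N)
    (h : ∀ a ∈ [z, N, ℓ, ℓ', κ, k, m, v, r₀, r₁, t₀, t₁, x, y], a < 2 ^ n)
    (hk : k + 1 < 2 ^ n) (hm : m + 1 < 2 ^ n) {φ : QVec}
    (hφ : ∀ q ∈ φ.support, ∀ b, q b < 2 ^ n) :
    ∃ (m' r₀' r₁' u t₁' x' y' : ℕ) (φ' : QVec),
      (if Nat.gcd v N = 1 then (u * v : ZMod N) = 1 ∧ m' = m + 1 ∧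
          φ' = moveState N k (3 * ℓ + 2 * m) u v φ else m' = m ∧ φ' = φ) ∧
      (∀ a ∈ [z, N, ℓ, ℓ', κ, k + 1, m', v, r₀', r₁', u, t₁', x', y'], a < 2 ^ n) ∧
      Runs ((n + 1) * (n + 1)) processRegister.weight processRegister
        (mem [z, N, ℓ, ℓ', κ, k, m, v, r₀, r₁, t₀, t₁, x, y]) φ
        (mem [z, N, ℓ, ℓ', κ, k + 1, m', v, r₀', r₁', u, t₁', x', y']) φ' := by
  have hM : n + 1 ≤ (n + 1) * (n + 1) := Nat.le_mul_of_pos_left _ (by omega)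
  obtain ⟨u, t', x', y', hu, hb, hr⟩ := euclid_runs hN h φ
  have hb' := hb
  simp only [List.mem_cons, List.not_mem_nil, or_false, forall_eq_or_imp, forall_eq] at hb'
  by_cases hg : Nat.gcd v N = 1
  · refine ⟨m + 1, Nat.gcd v N, 0, u, t', x', y', moveState N k (3 * ℓ + 2 * m) u v φ, ?_,
      by simp only [List.forall_mem_cons, forall_mem_nil_iff, and_true]; omega, ?_⟩
    · rw [if_pos hg]
      exact ⟨by simpa [hg] using hu, rfl, rfl⟩
    refine Runs.seq hr (Runs.seq (Runs.ite_neg (mem_lt hb) hM ?_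
      (moveRegister_runs hM hN hb hφ)) ?_)
    · simp [CExpr.eval, ArithOp.eval, mem, hg]
    · exact Runs.assign_mem
        (by simp only [List.forall_mem_cons, forall_mem_nil_iff, and_true]; omega) hM (by simp) rfl rfl _
  · refine ⟨m, Nat.gcd v N, 0, u, t', x', y', φ, ?_,
      (by simp only [List.forall_mem_cons, forall_mem_nil_iff, and_true]; omega), ?_⟩
    · rw [if_neg hg]
      exact ⟨rfl, rfl⟩
    refine Runs.seq hr (Runs.seq (Runs.ite_pos (mem_lt hb) hM ?_ (Runs.skip _ _ _)) ?_)
    · have : 0 < Nat.gcd v N := Nat.gcd_pos_of_pos_right _ (by omega)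
      simp [CExpr.eval, ArithOp.eval, mem]
      omega
    · exact Runs.assign_mem
        (by simp only [List.forall_mem_cons, forall_mem_nil_iff, and_true]; omega) hM (by simp) rfl rfl _

/-! ## Tensor products of states of disjoint sets of cells

The vectors of the quantum memory are the elements of a monoid algebra, whose multiplication is the
tensor product for vectors that live on disjoint sets of cells. -/

/-- The monoid algebra whose elements are the vectors of the quantum memory. -/
abbrev Poly : Type := AddMonoidAlgebra ℂ (ℕ →₀ ℕ)

theorem Poly.coeff_mul (F G : Poly) : (F * G).coeff =
    ∑ m ∈ F.coeff.support, ∑ m' ∈ G.coeff.support,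
      Finsupp.single (m + m') (F.coeff m * G.coeff m') := by
  rw [AddMonoidAlgebra.mul_def]
  simp [Finsupp.sum, AddMonoidAlgebra.coeff_sum]

theorem Poly.mem_support_mul {F G : Poly} {q : ℕ →₀ ℕ} (hq : q ∈ (F * G).coeff.support) :
    ∃ m ∈ F.coeff.support, ∃ m' ∈ G.coeff.support, q = m + m' := by
  classical
  obtain ⟨m, hm, m', hm', h⟩ := Finset.mem_add.1 (MvPolynomial.support_mul F G hq)
  exact ⟨m, hm, m', hm', h.symm⟩

/-- A basis map that ignores the second tensor factor acts on the first one only; by bilinearity it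
suffices to compare basis states. -/
theorem Poly.mapDomain_mul {F G : Poly} {π : (ℕ →₀ ℕ) → ℕ →₀ ℕ}
    (h : ∀ m ∈ F.coeff.support, ∀ m' ∈ G.coeff.support, π (m + m') = π m + m') :
    (F * G).coeff.mapDomain π = ((.ofCoeff (F.coeff.mapDomain π) : Poly) * G).coeff := by
  classical
  have e : (.ofCoeff (F.coeff.mapDomain π) : Poly) =
      ∑ m ∈ F.coeff.support, AddMonoidAlgebra.single (π m) (F.coeff m) := by
    refine AddMonoidAlgebra.coeff_injective ?_
    simp [AddMonoidAlgebra.coeff_sum, Finsupp.mapDomain, Finsupp.sum]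
  have e' : G = ∑ m' ∈ G.coeff.support, AddMonoidAlgebra.single m' (G.coeff m') :=
    (AddMonoidAlgebra.sum_coeff_single G).symm
  rw [Poly.coeff_mul, Finsupp.mapDomain_finsetSum, e]
  conv_rhs => rw [e', Finset.sum_mul_sum, AddMonoidAlgebra.coeff_sum]
  refine Finset.sum_congr rfl fun m hm => ?_
  rw [Finsupp.mapDomain_finsetSum, AddMonoidAlgebra.coeff_sum]
  refine Finset.sum_congr rfl fun m' hm' => ?_
  rw [Finsupp.mapDomain_single, AddMonoidAlgebra.single_mul_single, h m hm m' hm',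
    AddMonoidAlgebra.coeff_single]

theorem Poly.filter_mul {F G : Poly} {p : (ℕ →₀ ℕ) → Prop} [DecidablePred p]
    (h : ∀ m ∈ F.coeff.support, ∀ m' ∈ G.coeff.support, p (m + m') ↔ p m) :
    (F * G).coeff.filter p = ((.ofCoeff (F.coeff.filter p) : Poly) * G).coeff := by
  classical
  have e : (.ofCoeff (F.coeff.filter p) : Poly) =
      ∑ m ∈ F.coeff.support, if p m then AddMonoidAlgebra.single m (F.coeff m) else 0 := by
    refine AddMonoidAlgebra.coeff_injective ?_
    rw [← Finset.sum_filter, AddMonoidAlgebra.coeff_sum]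
    conv_lhs => rw [AddMonoidAlgebra.coeff_ofCoeff, ← Finsupp.sum_single (F.coeff.filter p)]
    rw [Finsupp.sum, Finsupp.support_filter]
    refine Finset.sum_congr rfl fun m hm => ?_
    rw [Finsupp.filter_apply_pos _ _ (Finset.mem_filter.1 hm).2, AddMonoidAlgebra.coeff_single]
  have e' : G = ∑ m' ∈ G.coeff.support, AddMonoidAlgebra.single m' (G.coeff m') :=
    (AddMonoidAlgebra.sum_coeff_single G).symm
  rw [Poly.coeff_mul, Finsupp.filter_sum, e]
  conv_rhs => rw [e', Finset.sum_mul_sum, AddMonoidAlgebra.coeff_sum]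
  refine Finset.sum_congr rfl fun m hm => ?_
  rw [Finsupp.filter_sum, AddMonoidAlgebra.coeff_sum]
  refine Finset.sum_congr rfl fun m' hm' => ?_
  by_cases hp : p m
  · rw [Finsupp.filter_single_of_pos _ ((h m hm m' hm').2 hp), if_pos hp,
      AddMonoidAlgebra.single_mul_single, AddMonoidAlgebra.coeff_single]
  · rw [Finsupp.filter_single_of_neg _ (mt (h m hm m' hm').1 hp), if_neg hp, zero_mul,
      AddMonoidAlgebra.coeff_zero]

/-- The vector `F` lives on the set `D` of cells: the other cells contain `0`. -/
def LivesOn (D : Set ℕ) (F : Poly) : Prop := ∀ q ∈ F.coeff.support, ∀ a ∉ D, q a = 0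

theorem LivesOn.mono {D D' : Set ℕ} {F : Poly} (h : LivesOn D F) (hD : D ⊆ D') : LivesOn D' F :=
  fun q hq a ha => h q hq a fun h' => ha (hD h')

theorem LivesOn.mul {D : Set ℕ} {F G : Poly} (hF : LivesOn D F) (hG : LivesOn D G) :
    LivesOn D (F * G) := by
  intro q hq a ha
  obtain ⟨m, hm, m', hm', rfl⟩ := Poly.mem_support_mul hq
  rw [Finsupp.add_apply, hF m hm a ha, hG m' hm' a ha]

theorem LivesOn.one (D : Set ℕ) : LivesOn D 1 := by
  intro q hq a _
  rw [AddMonoidAlgebra.one_def, AddMonoidAlgebra.coeff_single] at hq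
  rw [Finset.mem_singleton.1 (Finsupp.support_single_subset hq)]
  rfl

theorem LivesOn.prod {D : Set ℕ} {ι : Type*} {s : Finset ι} {F : ι → Poly}
    (h : ∀ i ∈ s, LivesOn D (F i)) : LivesOn D (∏ i ∈ s, F i) :=
  Finset.prod_induction _ _ (fun _ _ => LivesOn.mul) (LivesOn.one D) h

theorem LivesOn.sum_single {D : Set ℕ} {ι : Type*} {s : Finset ι} {b : ι → ℕ →₀ ℕ} {c : ι → ℂ}
    (h : ∀ i ∈ s, ∀ a ∉ D, b i a = 0) :
    LivesOn D (∑ i ∈ s, AddMonoidAlgebra.single (b i) (c i)) := by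
  classical
  intro q hq a ha
  rw [AddMonoidAlgebra.coeff_sum] at hq
  obtain ⟨i, hi, hq⟩ := Finset.mem_biUnion.1 (Finsupp.support_finsetSum hq)
  rw [AddMonoidAlgebra.coeff_single] at hq
  rw [Finset.mem_singleton.1 (Finsupp.support_single_subset hq)]
  exact h i hi a ha

theorem LivesOn.filter {D : Set ℕ} {F : Poly} (h : LivesOn D F) (p : (ℕ →₀ ℕ) → Prop)
    [DecidablePred p] : LivesOn D (.ofCoeff (F.coeff.filter p)) := by
  intro q hq
  rw [AddMonoidAlgebra.coeff_ofCoeff, Finsupp.support_filter, Finset.mem_filter] at hq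
  exact h q hq.1

/-! ## Weighted sums of squared amplitudes -/

/-- The sum of the squared amplitudes with the weights `W`. -/
def wsum (W : (ℕ →₀ ℕ) → ℝ) (ψ : QVec) : ℝ := ψ.sum fun q z => W q * ‖z‖ ^ 2

theorem normSq_eq_wsum (ψ : QVec) : ψ.normSq = wsum (fun _ => 1) ψ := by
  simp [QVec.normSq, wsum, Finsupp.sum]

theorem wsum_sum_single {ι : Type*} (W : (ℕ →₀ ℕ) → ℝ) (s : Finset ι) (b : ι → ℕ →₀ ℕ) (c : ι → ℂ)
    (hb : Set.InjOn b s) :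
    wsum W (∑ i ∈ s, Finsupp.single (b i) (c i)) = ∑ i ∈ s, W (b i) * ‖c i‖ ^ 2 := by
  classical
  induction s using Finset.induction_on with
  | empty => simp [wsum]
  | insert i s hi ih =>
    rw [Finset.sum_insert hi, Finset.sum_insert hi, ← ih (hb.mono (by simp))]
    unfold wsum
    rw [Finsupp.sum_add_index_of_disjoint, Finsupp.sum_single_index (by simp)]
    refine Finset.disjoint_left.2 fun q h1 h2 => ?_
    obtain ⟨j, hj, hq⟩ := Finset.mem_biUnion.1 (Finsupp.support_finsetSum h2)
    have e1 := Finset.mem_singleton.1 (Finsupp.support_single_subset h1)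
    have e2 := Finset.mem_singleton.1 (Finsupp.support_single_subset hq)
    have : i = j := hb (by simp) (by simp [hj]) (e1.symm.trans e2)
    exact hi (this ▸ hj)

/-- For disjoint sets of cells `m + m'` determines `m` and `m'`. Hence no two terms of the product
interfere, and squared amplitudes multiply. -/
theorem wsum_mul {D : Set ℕ} {F G : Poly} (hF : LivesOn D F) (hG : LivesOn Dᶜ G)
    {W : (ℕ →₀ ℕ) → ℝ} (hW : ∀ m ∈ F.coeff.support, ∀ m' ∈ G.coeff.support, W (m + m') = W m) :
    wsum W (F * G).coeff = wsum W F.coeff * QVec.normSq G.coeff := by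
  have hinj : Set.InjOn (fun x : (ℕ →₀ ℕ) × (ℕ →₀ ℕ) => x.1 + x.2)
      (F.coeff.support ×ˢ G.coeff.support : Finset _) := by
    rintro ⟨m, m'⟩ h ⟨p, p'⟩ h' e
    rw [Finset.mem_coe, Finset.mem_product] at h h'
    have : ∀ a, m a = p a ∧ m' a = p' a := by
      intro a
      have ea := DFunLike.congr_fun e a
      simp only [Finsupp.add_apply] at ea
      by_cases ha : a ∈ D
      · have h1 := hG m' h.2 a (by simpa using ha)
        have h2 := hG p' h'.2 a (by simpa using ha)
        omega
      · have h1 := hF m h.1 a ha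
        have h2 := hF p h'.1 a ha
        omega
    exact Prod.ext (Finsupp.ext fun a => (this a).1) (Finsupp.ext fun a => (this a).2)
  rw [Poly.coeff_mul, ← Finset.sum_product', wsum_sum_single _ _ _ _ hinj, Finset.sum_product,
    wsum, Finsupp.sum, QVec.normSq, Finset.sum_mul_sum]
  refine Finset.sum_congr rfl fun m hm => Finset.sum_congr rfl fun m' hm' => ?_
  rw [hW m hm m' hm', norm_mul]
  ring

theorem normSq_mul {D : Set ℕ} {F G : Poly} (hF : LivesOn D F) (hG : LivesOn Dᶜ G) :
    QVec.normSq (F * G).coeff = QVec.normSq F.coeff * QVec.normSq G.coeff := by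
  rw [normSq_eq_wsum, wsum_mul hF hG (fun _ _ _ _ => rfl), ← normSq_eq_wsum]

theorem normSq_nonneg (ψ : QVec) : 0 ≤ ψ.normSq := Finset.sum_nonneg fun _ _ => by positivity

/-- Summing over the outcomes of a measurement. -/
theorem sum_outcomes (ψ : QVec) (a : ℕ) (w : ℕ → ℝ) :
    ∑ v ∈ ψ.support.image (fun q => q a), w v * QVec.normSq (ψ.filter fun q => q a = v) =
      wsum (fun q => w (q a)) ψ := by
  classical
  rw [wsum, Finsupp.sum,
    ← Finset.sum_fiberwise_of_maps_to (g := fun q : ℕ →₀ ℕ => q a) fun q hq =>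
      Finset.mem_image_of_mem _ hq]
  refine Finset.sum_congr rfl fun v _ => ?_
  rw [QVec.normSq, Finsupp.support_filter, Finset.mul_sum]
  refine Finset.sum_congr rfl fun q hq => ?_
  rw [Finsupp.filter_apply_pos (fun q : ℕ →₀ ℕ => q a = v) _ (Finset.mem_filter.1 hq).2,
    (Finset.mem_filter.1 hq).2]

theorem normSq_xor (ψ : QVec) (a : ℕ) (f : (ℕ →₀ ℕ) → ℕ) : (ψ.xor a f).normSq = ψ.normSq := by
  have h := (xorBasis_involutive a f).injective
  rw [normSq_eq_wsum, normSq_eq_wsum, QVec.xor, Finsupp.mapDomain, Finsupp.sum,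
    wsum_sum_single _ _ _ _ h.injOn, wsum, Finsupp.sum]

theorem normSq_moveState (N k A u v : ℕ) (ψ : QVec) :
    (moveState N k A u v ψ).normSq = ψ.normSq := by
  simp only [moveState, normSq_xor]

/-- A gate on a cell where `G` contains `0` acts on `F` only, if it does not depend on `G`. -/
theorem xor_mul {F G : Poly} {a : ℕ} {f : (ℕ →₀ ℕ) → ℕ}
    (h : ∀ m' ∈ G.coeff.support, m' a = 0 ∧ ∀ m, f (m + m') = f m) :
    QVec.xor a f (F * G).coeff = ((.ofCoeff (QVec.xor a f F.coeff) : Poly) * G).coeff := by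
  refine Poly.mapDomain_mul fun m _ m' hm' => ?_
  obtain ⟨h1, h2⟩ := h m' hm'
  have e : (m + m').erase a = m.erase a + m' := by
    ext b
    by_cases hb : b = a
    · subst hb
      simp [h1]
    · simp [Finsupp.erase_ne hb]
  ext b
  simp only [xorBasis]
  rw [e, h2]
  by_cases hb : b = a
  · subst hb
    simp [h1]
  · simp [Finsupp.update_apply, hb]

/-! ## Single registers -/

/-- The content `j`, `y` of the Gaussian register with the number `k`. -/
def edcpCell (k : ℕ) (j : ℤ) (y : ℕ) : ℕ →₀ ℕ :=
  Finsupp.single (3 * k) (if j < 0 then 1 else 0) + Finsupp.single (3 * k + 1) j.natAbs +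
    Finsupp.single (3 * k + 2) y

/-- A Gaussian register. -/
def edcpReg {N : ℕ} (r : ℝ) (B : ℕ) (s x : ZMod N) (k : ℕ) : Poly :=
  ∑ j ∈ Finset.Icc (-(B : ℤ)) B,
    AddMonoidAlgebra.single (edcpCell k j (x + (j : ZMod N) * s).val) ((gaussAmp r B j : ℝ) : ℂ)

/-- A dihedral coset register at the address `b`. -/
def dcpReg {N : ℕ} [NeZero N] (s x : ZMod N) (b : ℕ) : Poly :=
  ∑ e : Fin 2 × ZMod N,
    AddMonoidAlgebra.single (Finsupp.single b (e.1 : ℕ) + Finsupp.single (b + 1) e.2.val)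
      (if e.2 = x + (e.1 : ℕ) * s then (((√2)⁻¹ : ℝ) : ℂ) else 0)

theorem edcpReg_livesOn {N : ℕ} (r : ℝ) (B : ℕ) (s x : ZMod N) (k : ℕ) :
    LivesOn {a | 3 * k ≤ a ∧ a < 3 * (k + 1)} (edcpReg r B s x k) := by
  refine LivesOn.sum_single fun j _ a ha => ?_
  rw [Set.mem_ofPred_eq] at ha
  simp only [edcpCell, Finsupp.add_apply, Finsupp.single_apply]
  rw [if_neg (by omega), if_neg (by omega), if_neg (by omega)]
  rfl

theorem dcpReg_livesOn {N : ℕ} [NeZero N] (s x : ZMod N) (b : ℕ) :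
    LivesOn {a | b ≤ a ∧ a < b + 2} (dcpReg s x b) := by
  refine LivesOn.sum_single fun j _ a ha => ?_
  rw [Set.mem_ofPred_eq] at ha
  simp only [Finsupp.add_apply, Finsupp.single_apply]
  rw [if_neg (by omega), if_neg (by omega)]
  rfl

theorem prod_single {ι : Type*} (s : Finset ι) (b : ι → ℕ →₀ ℕ) (c : ι → ℂ) :
    (∏ i ∈ s, AddMonoidAlgebra.single (b i) (c i) : Poly) =
      AddMonoidAlgebra.single (∑ i ∈ s, b i) (∏ i ∈ s, c i) := by
  classical
  induction s using Finset.induction_on with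
  | empty => simp [AddMonoidAlgebra.one_def]
  | insert i s hi ih =>
    rw [Finset.prod_insert hi, Finset.prod_insert hi, Finset.sum_insert hi, ih,
      AddMonoidAlgebra.single_mul_single]

theorem gEDCPState_eq_prod {N ℓ : ℕ} (r : ℝ) (B : ℕ) (s : ZMod N) (x : Fin ℓ → ZMod N) :
    gEDCPState r B s x = (∏ k : Fin ℓ, edcpReg r B s (x k) k).coeff := by
  simp only [edcpReg]
  rw [Finset.prod_univ_sum, AddMonoidAlgebra.coeff_sum, gEDCPState]
  refine Finset.sum_congr rfl fun j _ => ?_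
  rw [prod_single, AddMonoidAlgebra.coeff_single, Complex.ofReal_prod]
  rfl

/-- The product of dihedral coset registers at the address `b`. -/
theorem prod_dcpReg_eq {N ℓ : ℕ} [NeZero N] (s : ZMod N) (x : Fin ℓ → ZMod N) (b : ℕ) :
    ∏ i : Fin ℓ, dcpReg s (x i) (b + 2 * i) =
      ∑ d : DCPBasis N ℓ, AddMonoidAlgebra.single (dcpCells b d) (dcpState s x d) := by
  simp only [dcpReg]
  rw [Finset.prod_univ_sum, Fintype.piFinset_univ]
  refine Finset.sum_congr rfl fun d _ => ?_
  rw [prod_single]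
  rfl

theorem holdsDCP_of_eq {N ℓ : ℕ} [NeZero N] {s : ZMod N} {x : Fin ℓ → ZMod N} {b : ℕ} {χ : Poly}
    (hχ : LivesOn {a | ¬(b ≤ a ∧ a < b + 2 * ℓ)} χ) :
    HoldsDCP ℓ b s ((∏ i : Fin ℓ, dcpReg s (x i) (b + 2 * i)) * χ).coeff := by
  refine ⟨x, χ.coeff, fun z hz => ?_, ?_⟩
  · refine (Finsupp.filter_eq_self_iff _ _).2 fun a ha => ?_
    by_contra h
    exact ha (hχ z hz a (not_not_intro h))
  · rw [prod_dcpReg_eq, Finset.sum_mul, AddMonoidAlgebra.coeff_sum]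
    refine Finset.sum_congr rfl fun d _ => ?_
    conv_lhs => rw [← AddMonoidAlgebra.sum_coeff_single χ, Finsupp.sum, Finset.mul_sum,
      AddMonoidAlgebra.coeff_sum]
    rw [Finsupp.mapDomain, Finsupp.sum, Finset.smul_sum]
    refine Finset.sum_congr rfl fun z _ => ?_
    rw [AddMonoidAlgebra.single_mul_single, AddMonoidAlgebra.coeff_single, Finsupp.smul_single,
      smul_eq_mul, add_comm]

/-- The sign bit and the absolute value already determine `j`, so the terms of a Gaussian register
are orthogonal whatever the shift and the secret are. -/
theorem edcpCell_injective {k : ℕ} (y : ℤ → ℕ) :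
    Function.Injective fun j : ℤ => edcpCell k j (y j) := by
  intro i j h
  have h0 := DFunLike.congr_fun h (3 * k)
  have h1 := DFunLike.congr_fun h (3 * k + 1)
  simp [edcpCell] at h0 h1
  split_ifs at h0 <;> omega

theorem wsum_edcpReg {N : ℕ} (r : ℝ) (B : ℕ) (s x : ZMod N) (k : ℕ) (w : ℕ → ℝ) :
    wsum (fun q => w (q (3 * k + 1))) (edcpReg r B s x k).coeff =
      ∑ j ∈ Finset.Icc (-(B : ℤ)) B, w j.natAbs * gaussAmp r B j ^ 2 := by
  rw [edcpReg, AddMonoidAlgebra.coeff_sum]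
  simp only [AddMonoidAlgebra.coeff_single]
  rw [wsum_sum_single _ _ _ _ (edcpCell_injective _).injOn]
  refine Finset.sum_congr rfl fun j _ => ?_
  rw [Complex.norm_real, Real.norm_eq_abs, sq_abs]
  simp [edcpCell]

theorem rho_neg (r : ℝ) (j : ℤ) : rho r (-j) = rho r j := by simp [rho]

theorem gaussAmp_neg (r : ℝ) (B : ℕ) (j : ℤ) : gaussAmp r B (-j) = gaussAmp r B j := by
  simp [gaussAmp, rho_neg]

theorem sum_rho_pos (r : ℝ) (B : ℕ) : 0 < ∑ i ∈ Finset.Icc (-(B : ℤ)) B, rho r i ^ 2 :=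
  Finset.sum_pos (fun i _ => by unfold rho; positivity) ⟨0, by simp⟩

theorem gaussAmp_sq (r : ℝ) (B : ℕ) (j : ℤ) :
    gaussAmp r B j ^ 2 = rho r j ^ 2 / ∑ i ∈ Finset.Icc (-(B : ℤ)) B, rho r i ^ 2 := by
  rw [gaussAmp, div_pow, Real.sq_sqrt (sum_rho_pos r B).le]

theorem sum_gaussAmp_sq (r : ℝ) (B : ℕ) :
    ∑ j ∈ Finset.Icc (-(B : ℤ)) B, gaussAmp r B j ^ 2 = 1 := by
  simp only [gaussAmp_sq]
  rw [← Finset.sum_div, div_self (sum_rho_pos r B).ne']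

theorem normSq_edcpReg {N : ℕ} (r : ℝ) (B : ℕ) (s x : ZMod N) (k : ℕ) :
    QVec.normSq (edcpReg r B s x k).coeff = 1 := by
  rw [normSq_eq_wsum, wsum_edcpReg r B s x k fun _ => 1]
  simp [sum_gaussAmp_sq]

/-- The probability that the absolute value of a Gaussian register is prime to `N`. -/
def coprimeProb (N : ℕ) (r : ℝ) (B : ℕ) : ℝ :=
  ∑ j ∈ Finset.Icc (-(B : ℤ)) B, if Nat.gcd j.natAbs N = 1 then gaussAmp r B j ^ 2 else 0

/-- The generating function of the success of a single register. -/
theorem wsum_edcpReg_ite {N : ℕ} (r : ℝ) (B : ℕ) (s x : ZMod N) (k : ℕ) (z : ℝ) :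
    wsum (fun q => if Nat.gcd (q (3 * k + 1)) N = 1 then z else 1) (edcpReg r B s x k).coeff =
      1 - coprimeProb N r B + z * coprimeProb N r B := by
  rw [wsum_edcpReg r B s x k fun v => if Nat.gcd v N = 1 then z else 1, coprimeProb]
  conv_rhs => rw [← sum_gaussAmp_sq r B]
  rw [← Finset.sum_sub_distrib, Finset.mul_sum, ← Finset.sum_add_distrib]
  refine Finset.sum_congr rfl fun j _ => ?_
  split_ifs <;> ring

/-! ## Moving a register -/

/-- The content of a Gaussian register and of the dihedral coset register at the address `A`. -/
def loc (k A sg v y b z : ℕ) : ℕ →₀ ℕ :=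
  Finsupp.single (3 * k) sg + Finsupp.single (3 * k + 1) v + Finsupp.single (3 * k + 2) y +
    (Finsupp.single A b + Finsupp.single (A + 1) z)

section loc

variable {k A : ℕ} (hA : 3 * k + 3 ≤ A) (sg v y b z : ℕ)
include hA

theorem loc_apply_sign : loc k A sg v y b z (3 * k) = sg := by
  simp [loc, Finsupp.single_apply]
  omega

theorem loc_apply_val : loc k A sg v y b z (3 * k + 2) = y := by
  simp [loc, Finsupp.single_apply]
  omega

theorem loc_apply_bit : loc k A sg v y b z A = b := by
  simp only [loc, Finsupp.add_apply, Finsupp.single_apply]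
  rw [if_neg (by omega), if_neg (by omega), if_neg (by omega), if_neg (by omega : ¬A + 1 = A)]
  simp

theorem loc_apply_out : loc k A sg v y b z (A + 1) = z := by
  simp only [loc, Finsupp.add_apply, Finsupp.single_apply]
  rw [if_neg (by omega), if_neg (by omega), if_neg (by omega), if_neg (by omega)]
  simp

theorem xorBasis_loc_bit (f : (ℕ →₀ ℕ) → ℕ) :
    xorBasis A f (loc k A sg v y b z) = loc k A sg v y (b ^^^ f (loc k A sg v y 0 z)) z := by
  have e : (loc k A sg v y b z).erase A = loc k A sg v y 0 z := by
    ext a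
    by_cases ha : a = A
    · subst ha
      rw [Finsupp.erase_same, loc_apply_bit hA]
    · rw [Finsupp.erase_ne ha]
      simp [loc, Finsupp.single_apply, Ne.symm ha]
  rw [xorBasis, e, loc_apply_bit hA]
  ext a
  by_cases ha : a = A
  · subst ha
    simp [loc_apply_bit hA]
  · simp [Finsupp.update_apply, ha, loc, Finsupp.single_apply]

theorem xorBasis_loc_sign (f : (ℕ →₀ ℕ) → ℕ) :
    xorBasis (3 * k) f (loc k A sg v y b z) =
      loc k A (sg ^^^ f (loc k A 0 v y b z)) v y b z := by
  have e : (loc k A sg v y b z).erase (3 * k) = loc k A 0 v y b z := by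
    ext a
    by_cases ha : a = 3 * k
    · subst ha
      rw [Finsupp.erase_same, loc_apply_sign hA]
    · rw [Finsupp.erase_ne ha]
      simp [loc, Finsupp.single_apply, Ne.symm ha]
  rw [xorBasis, e, loc_apply_sign hA]
  ext a
  by_cases ha : a = 3 * k
  · subst ha
    simp [loc_apply_sign hA]
  · simp [Finsupp.update_apply, ha, loc, Finsupp.single_apply]

theorem xorBasis_loc_out (f : (ℕ →₀ ℕ) → ℕ) :
    xorBasis (A + 1) f (loc k A sg v y b z) =
      loc k A sg v y b (z ^^^ f (loc k A sg v y b 0)) := by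
  have e : (loc k A sg v y b z).erase (A + 1) = loc k A sg v y b 0 := by
    ext a
    by_cases ha : a = A + 1
    · subst ha
      rw [Finsupp.erase_same, loc_apply_out hA]
    · rw [Finsupp.erase_ne ha]
      simp [loc, Finsupp.single_apply, Ne.symm ha]
  rw [xorBasis, e, loc_apply_out hA]
  ext a
  by_cases ha : a = A + 1
  · subst ha
    simp [loc_apply_out hA]
  · simp [Finsupp.update_apply, ha, loc, Finsupp.single_apply]

theorem xorBasis_loc_val (f : (ℕ →₀ ℕ) → ℕ) :
    xorBasis (3 * k + 2) f (loc k A sg v y b z) =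
      loc k A sg v (y ^^^ f (loc k A sg v 0 b z)) b z := by
  have e : (loc k A sg v y b z).erase (3 * k + 2) = loc k A sg v 0 b z := by
    ext a
    by_cases ha : a = 3 * k + 2
    · subst ha
      rw [Finsupp.erase_same, loc_apply_val hA]
    · rw [Finsupp.erase_ne ha]
      simp [loc, Finsupp.single_apply, Ne.symm ha]
  rw [xorBasis, e, loc_apply_val hA]
  ext a
  by_cases ha : a = 3 * k + 2
  · subst ha
    simp [loc_apply_val hA]
  · simp [Finsupp.update_apply, ha, loc, Finsupp.single_apply]

end loc

theorem dcpReg_eq {N : ℕ} [NeZero N] (s x : ZMod N) (b : ℕ) :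
    dcpReg s x b =
      AddMonoidAlgebra.single (Finsupp.single b 0 + Finsupp.single (b + 1) x.val)
          (((√2)⁻¹ : ℝ) : ℂ) +
        AddMonoidAlgebra.single (Finsupp.single b 1 + Finsupp.single (b + 1) (x + s).val)
          (((√2)⁻¹ : ℝ) : ℂ) := by
  rw [dcpReg, Fintype.sum_prod_type, Fin.sum_univ_two]
  congr 1
  · rw [Finset.sum_eq_single x]
    · simp
    · intro y _ hy
      simp [hy]
    · simp
  · rw [Finset.sum_eq_single (x + s)]
    · simp
    · intro y _ hy
      simp [hy]
    · simp

/-- For `v ≤ B` exactly `j = v` and `j = -v` survive, with the same amplitude since `rho` is even.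
For `v > B` nothing survives and `c = 0`. -/
theorem filter_edcpReg {N : ℕ} (r : ℝ) (B : ℕ) (s x : ZMod N) (k A : ℕ) {v : ℕ} (hv : v ≠ 0) :
    ∃ c : ℂ, (edcpReg r B s x k).coeff.filter (fun q => q (3 * k + 1) = v) =
      Finsupp.single (loc k A 0 v (x + v * s).val 0 0) c +
        Finsupp.single (loc k A 1 v (x - v * s).val 0 0) c := by
  classical
  have e : (edcpReg r B s x k).coeff.filter (fun q => q (3 * k + 1) = v) =
      ∑ j ∈ (Finset.Icc (-(B : ℤ)) B).filter (fun j => j.natAbs = v),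
        Finsupp.single (edcpCell k j (x + (j : ZMod N) * s).val) ((gaussAmp r B j : ℝ) : ℂ) := by
    rw [edcpReg, AddMonoidAlgebra.coeff_sum, Finsupp.filter_sum, Finset.sum_filter]
    refine Finset.sum_congr rfl fun j _ => ?_
    have h : edcpCell k j (x + (j : ZMod N) * s).val (3 * k + 1) = j.natAbs := by simp [edcpCell]
    rw [AddMonoidAlgebra.coeff_single]
    split_ifs with hj
    · exact Finsupp.filter_single_of_pos _ (by rw [h, hj])
    · exact Finsupp.filter_single_of_neg _ (by rw [h]; exact hj)
  rw [e]
  by_cases hB : v ≤ B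
  · refine ⟨((gaussAmp r B v : ℝ) : ℂ), ?_⟩
    have e' : (Finset.Icc (-(B : ℤ)) B).filter (fun j => j.natAbs = v) = {(v : ℤ), -(v : ℤ)} := by
      ext j
      simp only [Finset.mem_filter, Finset.mem_Icc, Finset.mem_insert, Finset.mem_singleton]
      omega
    rw [e', Finset.sum_pair (by omega), gaussAmp_neg]
    have h1 : ¬(v : ℤ) < 0 := by omega
    have h2 : 0 < v := by omega
    simp [edcpCell, loc, h1, h2, sub_eq_add_neg]
  · refine ⟨0, ?_⟩
    rw [Finset.sum_eq_zero]
    · simp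
    · intro j hj
      simp only [Finset.mem_filter, Finset.mem_Icc] at hj
      omega

theorem moveState_single {N : ℕ} {k A u v sg y y' : ℕ} (hA : 3 * k + 3 ≤ A) (hsg : sg ≤ 1)
    (hy' : u * y % N = y') (hy : v * y' % N = y) (v' : ℕ) (c : ℂ) :
    moveState N k A u v (Finsupp.single (loc k A sg v' y 0 0) c) =
      Finsupp.single (loc k A 0 v' 0 (1 - sg) y') c := by
  simp only [moveState, QVec.xor, Finsupp.mapDomain_single]
  rw [xorBasis_loc_bit hA, loc_apply_sign hA, xorBasis_loc_sign hA, loc_apply_bit hA,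
    xorBasis_loc_out hA, loc_apply_val hA, xorBasis_loc_val hA, loc_apply_out hA]
  have h1 : sg ^^^ (1 - (0 ^^^ (1 - sg))) = 0 := by
    interval_cases sg <;> rfl
  rw [h1, Nat.zero_xor, Nat.zero_xor, hy', hy, Nat.xor_self]

theorem moveState_add (N k A u v : ℕ) (φ ψ : QVec) :
    moveState N k A u v (φ + ψ) = moveState N k A u v φ + moveState N k A u v ψ := by
  simp only [moveState, QVec.xor, Finsupp.mapDomain_add]

theorem mul_val_mod {N : ℕ} [NeZero N] (u : ℕ) (y z : ZMod N) (h : (u : ZMod N) * y = z) :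
    u * y.val % N = z.val := by
  rw [← h, ← ZMod.val_natCast]
  push_cast
  rw [ZMod.natCast_val, ZMod.cast_id]

theorem moveState_edcpReg {N : ℕ} [NeZero N] (r : ℝ) (B : ℕ) (s x : ZMod N) {k A u v : ℕ}
    (hA : 3 * k + 3 ≤ A) (hv : v ≠ 0) (hu : (u * v : ZMod N) = 1) :
    ∃ (x' : ZMod N) (c : ℂ),
      (.ofCoeff (moveState N k A u v
        ((edcpReg r B s x k).coeff.filter (fun q => q (3 * k + 1) = v))) : Poly) =
      dcpReg (2 * s) x' A * AddMonoidAlgebra.single (Finsupp.single (3 * k + 1) v) c := by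
  obtain ⟨c, hc⟩ := filter_edcpReg r B s x k A hv
  -- The shift is the branch `j = -v` times `u`; the other branch exceeds it by `2 * s`. The factor
  -- `√2` cancels the normalization of `dcpReg`.
  refine ⟨u * x - s, c * (√2 : ℝ), ?_⟩
  have h2 : (((√2)⁻¹ : ℝ) : ℂ) * (c * (√2 : ℝ)) = c := by
    rw [mul_left_comm, ← Complex.ofReal_mul, inv_mul_cancel₀ (by positivity)]
    simp
  rw [hc, moveState_add,
    moveState_single (y' := (u * x - s + 2 * s).val) hA zero_le_one
      (mul_val_mod _ _ _ (by linear_combination s * hu))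
      (mul_val_mod _ _ _ (by linear_combination x * hu)),
    moveState_single (y' := (u * x - s).val) hA le_rfl
      (mul_val_mod _ _ _ (by linear_combination -s * hu))
      (mul_val_mod _ _ _ (by linear_combination x * hu)),
    dcpReg_eq, add_mul, AddMonoidAlgebra.single_mul_single, AddMonoidAlgebra.single_mul_single, h2,
    add_comm]
  refine AddMonoidAlgebra.coeff_injective ?_
  simp [loc, add_comm]

theorem moveState_mul {N k A u v : ℕ} {F G : Poly} (hA : 3 * k + 3 ≤ A)
    (hG : LivesOn {a | ¬(3 * k ≤ a ∧ a < 3 * k + 3) ∧ ¬(A ≤ a ∧ a < A + 2)} G) :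
    moveState N k A u v (F * G).coeff =
      ((.ofCoeff (moveState N k A u v F.coeff) : Poly) * G).coeff := by
  have h : ∀ m' ∈ G.coeff.support,
      m' (3 * k) = 0 ∧ m' (3 * k + 2) = 0 ∧ m' A = 0 ∧ m' (A + 1) = 0 := by
    intro m' hm'
    refine ⟨?_, ?_, ?_, ?_⟩ <;> refine hG m' hm' _ ?_ <;> rw [Set.mem_ofPred_eq] <;> omega
  simp only [moveState]
  rw [xor_mul fun m' hm' => ?_, xor_mul fun m' hm' => ?_, xor_mul fun m' hm' => ?_,
    xor_mul fun m' hm' => ?_]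
  all_goals
    obtain ⟨h1, h2, h3, h4⟩ := h m' hm'
    simp [h1, h2, h3, h4]

/-! ## The main loop -/

/-- A factor for the time of one iteration of the main loop. -/
def stepWeight : ℕ :=
  1 + (Prog.measure (.lit 7) (.op .add srcAddr (.lit 1))).weight + processRegister.weight

/-- The invariant of the main loop after `k` iterations, for states whose cells all contain numbers
of at most `n` bits. -/
structure LoopInv {N : ℕ} [NeZero N] (n ℓ ℓ' κ : ℕ) (r : ℝ) (B : ℕ) (s : ZMod N) (X : ℕ → ZMod N)
    (T₀ k : ℕ) (σ : State) : Prop where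
  cmem : ∃ m v r₀ r₁ t₀ t₁ x y, m ≤ k ∧
    σ.cmem = mem [0, N, ℓ, ℓ', κ, k, m, v, r₀, r₁, t₀, t₁, x, y] ∧
    ∀ a ∈ [0, N, ℓ, ℓ', κ, k, m, v, r₀, r₁, t₀, t₁, x, y], a < 2 ^ n
  time : σ.time ≤ T₀ + k * (stepWeight * ((n + 1) * (n + 1)))
  lt : ∀ q ∈ σ.qmem.support, ∀ a, q a < 2 ^ n
  -- The factor `χ` collects what is left of the treated registers: the measured value after a
  -- success, the whole collapsed register after a failure.
  qmem : ∃ (x' : ℕ → ZMod N) (χ : Poly), LivesOn {a | a < 3 * k} χ ∧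
    σ.qmem = ((∏ i ∈ Finset.range (σ.cmem 6), dcpReg (2 * s) (x' i) (3 * ℓ + 2 * i)) *
      (∏ i ∈ Finset.Ico k ℓ, edcpReg r B s (X i) i) * χ).coeff

section step

variable {N : ℕ} [NeZero N] {n ℓ ℓ' κ : ℕ} {r : ℝ} {B : ℕ} {s : ZMod N} {X : ℕ → ZMod N} {T₀ k : ℕ}
  {σ : State}

/-- The register that is treated next is in tensor product with the rest. -/
theorem LoopInv.split (h : LoopInv n ℓ ℓ' κ r B s X T₀ k σ) (hk : k < ℓ) :
    ∃ (x' : ℕ → ZMod N) (χ : Poly), LivesOn {a | a < 3 * k} χ ∧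
      ∃ D R : Poly, D = ∏ i ∈ Finset.range (σ.cmem 6), dcpReg (2 * s) (x' i) (3 * ℓ + 2 * i) ∧
      R = ∏ i ∈ Finset.Ico (k + 1) ℓ, edcpReg r B s (X i) i ∧
      LivesOn {a | ¬(3 * k ≤ a ∧ a < 3 * k + 3) ∧
        ¬(3 * ℓ + 2 * σ.cmem 6 ≤ a ∧ a < 3 * ℓ + 2 * σ.cmem 6 + 2)} (D * R * χ) ∧
      σ.qmem = (edcpReg r B s (X k) k * (D * R * χ)).coeff := by
  obtain ⟨x', χ, hχ, e⟩ := h.qmem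
  refine ⟨x', χ, hχ, _, _, rfl, rfl, ((LivesOn.prod fun i hi => ?_).mul
    (LivesOn.prod fun i hi => ?_)).mul (hχ.mono fun a ha => ?_), ?_⟩
  · refine (dcpReg_livesOn _ _ _).mono fun a ha => ?_
    rw [Finset.mem_range] at hi
    rw [Set.mem_ofPred_eq] at ha ⊢
    omega
  · refine (edcpReg_livesOn _ _ _ _ _).mono fun a ha => ?_
    rw [Finset.mem_Ico] at hi
    rw [Set.mem_ofPred_eq] at ha ⊢
    omega
  · rw [Set.mem_ofPred_eq] at ha ⊢
    omega
  · rw [e, Finset.prod_eq_prod_Ico_succ_bot hk]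
    congr 1
    ring

theorem LoopInv.exec_outcome (h : LoopInv n ℓ ℓ' κ r B s X T₀ k σ) (hk : k < ℓ) (hN : 2 ≤ N)
    {v : ℕ} (hv : v ∈ σ.qmem.support.image fun q => q (3 * k + 1)) (t : ℕ)
    (ht : t ≤ (Prog.measure (.lit 7) (.op .add srcAddr (.lit 1))).weight * (n + 1)) :
    ∃ τ : State, processRegister.exec
        { cmem := Function.update σ.cmem 7 v
          qmem := σ.qmem.filter fun q => q (3 * k + 1) = v
          time := σ.time + 1 + t } = {τ} ∧
      LoopInv n ℓ ℓ' κ r B s X T₀ (k + 1) τ ∧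
      τ.qmem.normSq = QVec.normSq (σ.qmem.filter fun q => q (3 * k + 1) = v) ∧
      τ.cmem 6 = if Nat.gcd v N = 1 then σ.cmem 6 + 1 else σ.cmem 6 := by
  obtain ⟨m, v', r₀, r₁, t₀, t₁, x, y, hm, hc, hb⟩ := h.cmem
  have h6 : σ.cmem 6 = m := by rw [hc]; rfl
  obtain ⟨x', χ, hχ, D, R, hD, hR, hG, hq⟩ := h.split hk
  rw [h6] at hD hG
  rw [h6, hc, update_mem (by simp) v]
  simp only [List.forall_mem_cons, forall_mem_nil_iff, and_true] at hb
  obtain ⟨q, hq', rfl⟩ := Finset.mem_image.1 hv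
  have hvn := h.lt q hq' (3 * k + 1)
  have hlt : ∀ p ∈ (σ.qmem.filter fun p => p (3 * k + 1) = q (3 * k + 1)).support,
      ∀ a, p a < 2 ^ n := by
    intro p hp
    rw [Finsupp.support_filter, Finset.mem_filter] at hp
    exact h.lt p hp.1
  generalize q (3 * k + 1) = v at *
  obtain ⟨m', r₀', r₁', u, t₁', y', y'', φ', hif, hb', hr⟩ := processRegister_runs (n := n)
    (z := 0) (ℓ := ℓ) (ℓ' := ℓ') (κ := κ) (k := k) (m := m) (v := v) (r₀ := r₀) (r₁ := r₁)
    (t₀ := t₀) (t₁ := t₁) (x := x) (y := y) hN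
    (by simp only [List.forall_mem_cons, forall_mem_nil_iff, and_true]; omega)
    (by omega) (by omega) hlt
  obtain ⟨T', hT', e⟩ := hr (σ.time + 1 + t)
  have hfil : (σ.qmem.filter fun q => q (3 * k + 1) = v) =
      ((.ofCoeff ((edcpReg r B s (X k) k).coeff.filter fun q => q (3 * k + 1) = v) : Poly) *
        (D * R * χ)).coeff := by
    rw [hq]
    refine Poly.filter_mul fun p _ p' hp' => ?_
    rw [Finsupp.add_apply, hG p' hp' (3 * k + 1) (by rw [Set.mem_ofPred_eq]; omega), add_zero]
  have hEv : LivesOn {a | a < 3 * (k + 1)}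
      (.ofCoeff ((edcpReg r B s (X k) k).coeff.filter fun q => q (3 * k + 1) = v)) :=
    ((edcpReg_livesOn r B s (X k) k).filter _).mono fun a ha => ha.2
  have htime : T' ≤ T₀ + (k + 1) * (stepWeight * ((n + 1) * (n + 1))) := by
    have h1 := h.time
    have h2 : n + 1 ≤ (n + 1) * (n + 1) := Nat.le_mul_of_pos_left _ (by omega)
    have h3 := ht.trans (Nat.mul_le_mul_left _ h2)
    have h4 : stepWeight * ((n + 1) * (n + 1)) = (n + 1) * (n + 1) +
      (Prog.measure (.lit 7) (.op .add srcAddr (.lit 1))).weight * ((n + 1) * (n + 1)) +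
      processRegister.weight * ((n + 1) * (n + 1)) := by
      rw [stepWeight]; ring
    rw [add_mul k 1, one_mul]
    omega
  have hχ' : LivesOn {a | a < 3 * (k + 1)} χ := hχ.mono fun a ha => by
    rw [Set.mem_ofPred_eq] at ha ⊢; omega
  refine ⟨_, e, ?_, ?_, ?_⟩
  · by_cases hg : Nat.gcd v N = 1
    · rw [if_pos hg] at hif
      obtain ⟨hu, rfl, rfl⟩ := hif
      refine ⟨⟨_, _, _, _, _, _, _, _, by omega, rfl, hb'⟩, htime,
        moveState_lt (by omega) hb.2.1 hlt, ?_⟩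
      -- The outcome `0`, which leaves a single branch, is never a success since `gcd(0, N) = N ≥
      -- 2`.
      have hv0 : v ≠ 0 := by
        rintro rfl
        rw [Nat.gcd_zero_left] at hg
        omega
      obtain ⟨x₁, c, hx₁⟩ := moveState_edcpReg r B s (X k) (k := k)
        (A := 3 * ℓ + 2 * m) (by omega) hv0 hu
      refine ⟨Function.update x' m x₁,
        AddMonoidAlgebra.single (Finsupp.single (3 * k + 1) v) c * χ, LivesOn.mul ?_ hχ', ?_⟩
      · intro p hp a ha
        rw [AddMonoidAlgebra.coeff_single] at hp
        rw [Finset.mem_singleton.1 (Finsupp.support_single_subset hp)]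
        rw [Set.mem_ofPred_eq] at ha
        exact Finsupp.single_eq_of_ne (by omega)
      · change moveState N k (3 * ℓ + 2 * m) u v _ = ((∏ i ∈ Finset.range (m + 1),
          dcpReg (2 * s) (Function.update x' m x₁ i) (3 * ℓ + 2 * i)) *
          (∏ i ∈ Finset.Ico (k + 1) ℓ, edcpReg r B s (X i) i) *
          (AddMonoidAlgebra.single (Finsupp.single (3 * k + 1) v) c * χ) : Poly).coeff
        rw [hfil, moveState_mul (by omega) hG, AddMonoidAlgebra.coeff_ofCoeff, hx₁,
          Finset.prod_range_succ, Function.update_self, hD, hR]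
        have hD' : ∏ i ∈ Finset.range m, dcpReg (2 * s) (Function.update x' m x₁ i) (3 * ℓ + 2 * i)
            = ∏ i ∈ Finset.range m, dcpReg (2 * s) (x' i) (3 * ℓ + 2 * i) :=
          Finset.prod_congr rfl fun i hi => by
            rw [Function.update_of_ne (Finset.mem_range.1 hi).ne]
        rw [hD']
        congr 1
        ring
    · rw [if_neg hg] at hif
      obtain ⟨rfl, rfl⟩ := hif
      -- A failed register is left in place and absorbed into `χ`.
      refine ⟨⟨_, _, _, _, _, _, _, _, by omega, rfl, hb'⟩, htime, hlt, x', _,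
        LivesOn.mul hEv hχ', ?_⟩
      change _ = ((∏ i ∈ Finset.range m', dcpReg (2 * s) (x' i) (3 * ℓ + 2 * i)) *
        (∏ i ∈ Finset.Ico (k + 1) ℓ, edcpReg r B s (X i) i) *
        ((.ofCoeff ((edcpReg r B s (X k) k).coeff.filter fun q => q (3 * k + 1) = v) : Poly) * χ) :
          Poly).coeff
      change (σ.qmem.filter fun q => q (3 * k + 1) = v) = _
      rw [hfil, hD, hR]
      congr 1
      ring
  · by_cases hg : Nat.gcd v N = 1
    · rw [if_pos hg] at hif
      obtain ⟨-, -, rfl⟩ := hif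
      exact normSq_moveState _ _ _ _ _ _
    · rw [if_neg hg] at hif
      obtain ⟨-, rfl⟩ := hif
      rfl
  · change m' = _
    split_ifs at hif ⊢
    · exact hif.2.1
    · exact hif.1

theorem LoopInv.exec_step (h : LoopInv n ℓ ℓ' κ r B s X T₀ k σ) (hk : k < ℓ) (hN : 2 ≤ N) :
    ∃ τ : ℕ → State, registerStep.exec (σ.tick 1) =
        (σ.qmem.support.image fun q => q (3 * k + 1)).val.map τ ∧
      ∀ v ∈ σ.qmem.support.image fun q => q (3 * k + 1),
        LoopInv n ℓ ℓ' κ r B s X T₀ (k + 1) (τ v) ∧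
        (τ v).qmem.normSq = QVec.normSq (σ.qmem.filter fun q => q (3 * k + 1) = v) ∧
        (τ v).cmem 6 = if Nat.gcd v N = 1 then σ.cmem 6 + 1 else σ.cmem 6 := by
  obtain ⟨m, v', r₀, r₁, t₀, t₁, x, y, hm, hc, hb⟩ := h.cmem
  have hcost : ∀ v ∈ σ.qmem.support.image fun q => q (3 * k + 1),
      (CExpr.lit 7).cost σ.cmem + (CExpr.op .add srcAddr (.lit 1)).cost σ.cmem + 1 + Nat.size v ≤
        (Prog.measure (.lit 7) (.op .add srcAddr (.lit 1))).weight * (n + 1) := by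
    intro v hv
    obtain ⟨q, hq', rfl⟩ := Finset.mem_image.1 hv
    have h1 : ∀ a, σ.cmem a < 2 ^ n := by rw [hc]; exact mem_lt hb
    have h2 := CExpr.cost_le h1 (.lit 7) le_rfl
    have h3 := CExpr.cost_le h1 (.op .add srcAddr (.lit 1)) le_rfl
    have h4 : Nat.size (q (3 * k + 1)) ≤ n := Nat.size_le.2 (h.lt q hq' _)
    simp only [Prog.weight, add_mul, one_mul]
    omega
  have : Nonempty State := ⟨σ⟩
  choose! τ hτ hτ' using fun v (hv : v ∈ σ.qmem.support.image fun q => q (3 * k + 1)) =>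
    h.exec_outcome hk hN hv _ (hcost v hv)
  refine ⟨τ, ?_, hτ'⟩
  have e5 : (CExpr.op .add srcAddr (.lit 1)).eval (σ.tick 1).cmem = 3 * k + 1 := by
    change 3 * σ.cmem 5 + 1 = _
    rw [hc]
    rfl
  rw [registerStep, Prog.exec, Prog.exec, e5, Multiset.bind_map, ← Multiset.bind_singleton]
  exact Multiset.bind_congr fun v hv => hτ v hv

/-- The effect of an iteration on the generating function of the number of successes. -/
theorem LoopInv.sum_step (h : LoopInv n ℓ ℓ' κ r B s X T₀ k σ) (hk : k < ℓ) (hN : 2 ≤ N) (z : ℝ) :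
    ((registerStep.exec (σ.tick 1)).map fun τ => z ^ τ.cmem 6 * τ.qmem.normSq).sum =
      (1 - coprimeProb N r B + z * coprimeProb N r B) * (z ^ σ.cmem 6 * σ.qmem.normSq) := by
  obtain ⟨τ, hτ, hτ'⟩ := h.exec_step hk hN
  obtain ⟨x', χ, hχ, D, R, hD, hR, hG, hq⟩ := h.split hk
  have hG' : LivesOn {a | 3 * k ≤ a ∧ a < 3 * (k + 1)}ᶜ (D * R * χ) := hG.mono fun a ha => ha.1
  rw [hτ, Multiset.map_map]
  have e1 : ∀ v ∈ σ.qmem.support.image fun q => q (3 * k + 1),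
      z ^ (τ v).cmem 6 * (τ v).qmem.normSq = z ^ σ.cmem 6 * ((if Nat.gcd v N = 1 then z else 1) *
        QVec.normSq (σ.qmem.filter fun q => q (3 * k + 1) = v)) := by
    intro v hv
    rw [(hτ' v hv).2.1, (hτ' v hv).2.2]
    split_ifs <;> ring
  refine (congrArg Multiset.sum (Multiset.map_congr rfl fun v hv => e1 v hv)).trans ?_
  change ∑ v ∈ σ.qmem.support.image fun q => q (3 * k + 1), _ = _
  -- Averaging over the outcomes gives a weighted norm whose weight reads the current register only.
  -- It therefore factors, and the rest contributes its plain norm.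
  rw [← Finset.mul_sum, sum_outcomes σ.qmem (3 * k + 1) fun v => if Nat.gcd v N = 1 then z else 1,
    hq, wsum_mul (edcpReg_livesOn r B s (X k) k) hG', wsum_edcpReg_ite,
    normSq_mul (edcpReg_livesOn r B s (X k) k) hG', normSq_edcpReg]
  · ring
  · intro p _ p' hp'
    rw [Finsupp.add_apply, hG p' hp' (3 * k + 1) (by rw [Set.mem_ofPred_eq]; omega), add_zero]

end step

/-! ## Lower bounds for the success probability of a register -/

theorem rho_sq (r : ℝ) (j : ℤ) : rho r j ^ 2 = Real.exp (-2 * Real.pi * ((j : ℝ) / r) ^ 2) := by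
  rw [rho, ← Real.exp_nat_mul]
  congr 1
  push_cast
  ring

theorem sum_natAbs_le {f : ℕ → ℝ} (hf : ∀ k, 0 ≤ f k) (B : ℕ) :
    ∑ j ∈ Finset.Icc (-(B : ℤ)) B, f j.natAbs ≤ ∑ k ∈ Finset.range (B + 1), 2 * f k := by
  rw [← Finset.sum_fiberwise_of_maps_to (t := Finset.range (B + 1)) (g := Int.natAbs)
    fun j hj => by rw [Finset.mem_Icc] at hj; rw [Finset.mem_range]; omega]
  refine Finset.sum_le_sum fun k _ => ?_
  rw [Finset.sum_congr rfl (g := fun _ => f k) fun j hj => by rw [(Finset.mem_filter.1 hj).2],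
    Finset.sum_const, nsmul_eq_mul]
  refine mul_le_mul_of_nonneg_right ?_ (hf k)
  have h : (Finset.Icc (-(B : ℤ)) B).filter (fun j => j.natAbs = k) ⊆ {(k : ℤ), -(k : ℤ)} := by
    intro j hj
    rw [Finset.mem_filter] at hj
    rw [Finset.mem_insert, Finset.mem_singleton]
    omega
  exact_mod_cast (Finset.card_le_card h).trans Finset.card_le_two

/-- A factor for the upper bound of the Gaussian sum. -/
def gaussConst : ℝ := 2 * Real.exp (Real.pi / 2)

theorem gaussConst_pos : 0 < gaussConst := by unfold gaussConst; positivity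

/-- From `t² ≥ t - 1/4` with `t = |j| / r`, the Gaussian is at most `exp(π/2)` times a geometric
sequence of ratio `y = exp(-x)`, `x = 2π / r`. Since `y ≤ 1 / (1 + x)`, the series is at most `1 + 1
/ x ≤ 1 + r`. -/
theorem sum_rho_sq_le {r : ℝ} (hr : 0 < r) (B : ℕ) :
    ∑ j ∈ Finset.Icc (-(B : ℤ)) B, rho r j ^ 2 ≤ gaussConst * (1 + r) := by
  set x := 2 * Real.pi / r with hx
  have hπ := Real.pi_gt_three
  have hx0 : 0 < x := by positivity
  set y := Real.exp (-x) with hy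
  have hy1 : y < 1 := by rw [hy, ← Real.exp_zero, Real.exp_lt_exp]; linarith
  have h1 : ∀ j ∈ Finset.Icc (-(B : ℤ)) B,
      rho r j ^ 2 ≤ (fun k : ℕ => Real.exp (Real.pi / 2) * y ^ k) j.natAbs := by
    intro j _
    rw [rho_sq]
    simp only
    rw [hy, ← Real.exp_nat_mul, ← Real.exp_add, Real.exp_le_exp, hx, Nat.cast_natAbs, Int.cast_abs,
      ← sq_abs ((j : ℝ) / r), abs_div, abs_of_pos hr]
    have : |(j : ℝ)| * -(2 * Real.pi / r) = -2 * Real.pi * (|(j : ℝ)| / r) := by ring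
    rw [this]
    nlinarith [sq_nonneg (|(j : ℝ)| / r - 1 / 2)]
  refine (Finset.sum_le_sum h1).trans ((sum_natAbs_le (f := fun k : ℕ =>
    Real.exp (Real.pi / 2) * y ^ k) (fun k => by positivity) B).trans ?_)
  rw [← Finset.mul_sum, ← Finset.mul_sum, gaussConst, mul_assoc]
  refine mul_le_mul_of_nonneg_left (mul_le_mul_of_nonneg_left ?_ (by positivity)) (by norm_num)
  have h2 : ∑ k ∈ Finset.range (B + 1), y ^ k ≤ 1 / (1 - y) := by
    rw [geom_sum_eq hy1.ne, ← neg_div_neg_eq, neg_sub, neg_sub]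
    exact div_le_div_of_nonneg_right (by linarith [pow_pos (Real.exp_pos (-x)) (B + 1)])
      (by linarith)
  have h3 : y * (1 + x) ≤ 1 := by
    have := Real.add_one_le_exp x
    calc y * (1 + x) ≤ y * Real.exp x := by
          refine mul_le_mul_of_nonneg_left (by linarith) (Real.exp_pos _).le
      _ = 1 := by rw [hy, ← Real.exp_add]; simp
  refine h2.trans ((div_le_iff₀ (by linarith)).2 ?_)
  have h4 : x * r = 2 * Real.pi := by rw [hx]; field_simp
  nlinarith

theorem coprimeProb_ge {N B : ℕ} {r w : ℝ} (hr : 0 < r) {S : Finset ℕ}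
    (hS : ∀ a ∈ S, a ≤ B ∧ Nat.gcd a N = 1 ∧ w ≤ rho r a ^ 2) :
    S.card * w / (gaussConst * (1 + r)) ≤ coprimeProb N r B := by
  have hZ := sum_rho_pos r B
  have h1 : (S.card : ℝ) * w ≤ ∑ a ∈ S, rho r (a : ℤ) ^ 2 := by
    rw [← nsmul_eq_mul]
    exact Finset.card_nsmul_le_sum _ _ _ fun a ha => (hS a ha).2.2
  have h2 : (∑ a ∈ S, rho r (a : ℤ) ^ 2) / (∑ i ∈ Finset.Icc (-(B : ℤ)) B, rho r i ^ 2) ≤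
      coprimeProb N r B := by
    rw [coprimeProb, ← Finset.sum_filter, Finset.sum_div,
      ← Finset.sum_image (s := S) (g := fun a : ℕ => (a : ℤ))
        (f := fun j => rho r j ^ 2 / (∑ i ∈ Finset.Icc (-(B : ℤ)) B, rho r i ^ 2))
        (fun a _ b _ h => Nat.cast_injective h)]
    simp only [gaussAmp_sq]
    refine Finset.sum_le_sum_of_subset_of_nonneg (fun j hj => ?_) fun j _ _ => by positivity
    obtain ⟨a, ha, rfl⟩ := Finset.mem_image.1 hj
    rw [Finset.mem_filter, Finset.mem_Icc]
    have := hS a ha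
    exact ⟨by omega, by simpa using this.2.1⟩
  refine le_trans ?_ h2
  exact div_le_div₀ (Finset.sum_nonneg fun _ _ => by positivity) h1 hZ (sum_rho_sq_le hr B)

theorem coprimeProb_le_one (N : ℕ) (r : ℝ) (B : ℕ) : coprimeProb N r B ≤ 1 := by
  rw [← sum_gaussAmp_sq r B]
  exact Finset.sum_le_sum fun j _ => by split_ifs <;> [exact le_rfl; positivity]

/-- The number `1` is prime to every `N`. The lower bound `r₀` keeps its weight away from `0` and
gives `1 + r ≤ (1 / r₀ + 1) * r`. -/
theorem coprimeProb_ge_div {r₀ : ℝ} (hr₀ : 0 < r₀) :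
    ∃ c, 0 < c ∧ ∀ (N B : ℕ) (r : ℝ), r₀ ≤ r → 1 ≤ B → c / r ≤ coprimeProb N r B := by
  refine ⟨Real.exp (-2 * Real.pi * (1 / r₀) ^ 2) / (gaussConst * (1 / r₀ + 1)),
    div_pos (Real.exp_pos _) (mul_pos gaussConst_pos (by positivity)), fun N B r hr hB => ?_⟩
  have hr' : 0 < r := hr₀.trans_le hr
  refine le_trans ?_ (coprimeProb_ge (S := {1}) (w := Real.exp (-2 * Real.pi * (1 / r₀) ^ 2)) hr' ?_)
  · rw [div_div, Finset.card_singleton, Nat.cast_one, one_mul]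
    refine div_le_div_of_nonneg_left (Real.exp_pos _).le
      (mul_pos gaussConst_pos (by positivity)) ?_
    rw [mul_assoc]
    refine mul_le_mul_of_nonneg_left ?_ gaussConst_pos.le
    have : 1 ≤ 1 / r₀ * r := by rw [one_div, inv_mul_eq_div]; exact (one_le_div hr₀).2 hr
    linarith
  · intro a ha
    rw [Finset.mem_singleton.1 ha]
    refine ⟨hB, Nat.gcd_one_left N, ?_⟩
    rw [rho_sq, Real.exp_le_exp]
    have h1 : ((1 : ℕ) : ℤ) / r ≤ 1 / r₀ := by
      push_cast
      exact one_div_le_one_div_of_le hr₀ hr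
    have h2 : (0 : ℝ) ≤ ((1 : ℕ) : ℤ) / r := by positivity
    have h3 := pow_le_pow_left₀ h2 h1 2
    have := Real.pi_pos
    nlinarith

/-- Chebyshev's elementary bound has the main term `x log 2` and an error of order `√x log x =
o(x)`; the slope suffices since `log 2 > 1/2`. -/
theorem eventually_half_le_theta : ∀ᶠ x : ℝ in Filter.atTop, x / 2 ≤ Chebyshev.theta x := by
  have h1 : (fun x : ℝ => √x * Real.log x) =o[Filter.atTop] fun x : ℝ => √x * √x := by
    refine (Asymptotics.isBigO_refl _ _).mul_isLittleO ?_
    rw [show Real.sqrt = fun x => x ^ (1 / 2 : ℝ) from funext Real.sqrt_eq_rpow]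
    exact isLittleO_log_rpow_atTop (by norm_num : (0 : ℝ) < 1 / 2)
  filter_upwards [h1.bound (by norm_num : (0 : ℝ) < 1 / 100), Filter.eventually_ge_atTop 1000]
    with x hx hx1
  have hl : 0 ≤ Real.log x := Real.log_nonneg (by linarith)
  rw [Real.mul_self_sqrt (by linarith), Real.norm_of_nonneg (by positivity),
    Real.norm_of_nonneg (by linarith)] at hx
  have h2 := Chebyshev.theta_ge' (x := x) (by linarith)
  have h3 : Real.log (x + 2) ≤ 2 * Real.log x := by
    rw [← Real.log_rpow (by linarith)]
    refine Real.log_le_log (by linarith) ?_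
    norm_num
    nlinarith
  have h4 : 1 ≤ √x := Real.one_le_sqrt.2 (by linarith)
  have h5 := Real.log_two_gt_d9
  nlinarith

/-- There are many numbers prime to `N` up to `3 log N`. -/
theorem card_coprime_ge : ∃ c : ℝ, 0 < c ∧ ∀ (N : ℕ) (r : ℝ), 2 ≤ N → 3 * Real.log N ≤ r →
    c * (r / Real.log r) ≤ ((Finset.Icc 1 ⌊r⌋₊).filter fun a => Nat.gcd a N = 1).card := by
  obtain ⟨R, hR⟩ := Filter.eventually_atTop.1 eventually_half_le_theta
  -- For `r ≥ R` the constant is `1/6 = 1/2 - 1/3`, from `θ(r) ≥ r / 2` and `log N ≤ r / 3`. The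
  -- second constant covers `2 ≤ r < R`, where the single number `1` suffices.
  refine ⟨min (1 / 6) (Real.log 2 / max R 1), by positivity, fun N r hN hr => ?_⟩
  have hlog2 := Real.log_two_gt_d9
  have hN2 : Real.log 2 ≤ Real.log N := Real.log_le_log (by norm_num) (by exact_mod_cast hN)
  have hr2 : 2 ≤ r := by linarith
  have hlr : Real.log 2 ≤ Real.log r := Real.log_le_log (by norm_num) hr2
  have hlr0 : 0 < Real.log r := by linarith
  set S := (Finset.Icc 1 ⌊r⌋₊).filter fun a => Nat.gcd a N = 1 with hS
  by_cases hrR : R ≤ r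
  · have h1 := hR r hrR
    have h2 : Chebyshev.theta r - Real.log N ≤ S.card * Real.log r := by
      rw [Chebyshev.theta_eq_sum_Icc,
        ← Finset.sum_filter_add_sum_filter_not _ fun p => p ∣ N]
      -- The product of the distinct primes dividing `N` divides `N`.
      have h3 : ∑ p ∈ ((Finset.Icc 0 ⌊r⌋₊).filter Nat.Prime).filter (fun p => p ∣ N), Real.log p ≤
          Real.log N := by
        rw [← Real.log_prod fun p hp => by
          have := (Finset.mem_filter.1 (Finset.mem_filter.1 hp).1).2.pos
          positivity]
        have h5 : (∏ p ∈ ((Finset.Icc 0 ⌊r⌋₊).filter Nat.Prime).filter (fun p => p ∣ N), p) ∣ N :=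
          Finset.prod_primes_dvd N
            (fun p hp => (Finset.mem_filter.1 (Finset.mem_filter.1 hp).1).2.prime)
            fun p hp => (Finset.mem_filter.1 hp).2
        have h6 : 0 < ∏ p ∈ ((Finset.Icc 0 ⌊r⌋₊).filter Nat.Prime).filter (fun p => p ∣ N), p :=
          Nat.pos_of_dvd_of_pos h5 (by omega)
        rw [← Nat.cast_prod]
        exact Real.log_le_log (by exact_mod_cast h6)
          (by exact_mod_cast Nat.le_of_dvd (by omega) h5)
      have h4 : ∑ p ∈ ((Finset.Icc 0 ⌊r⌋₊).filter Nat.Prime).filter (fun p => ¬p ∣ N),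
          Real.log p ≤ S.card * Real.log r := by
        have hsub : ((Finset.Icc 0 ⌊r⌋₊).filter Nat.Prime).filter (fun p => ¬p ∣ N) ⊆ S := by
          intro p hp
          simp only [Finset.mem_filter, Finset.mem_Icc] at hp
          rw [hS, Finset.mem_filter, Finset.mem_Icc]
          exact ⟨⟨hp.1.2.one_le, hp.1.1.2⟩, (Nat.Prime.coprime_iff_not_dvd hp.1.2).2 hp.2⟩
        calc _ ≤ (((Finset.Icc 0 ⌊r⌋₊).filter Nat.Prime).filter (fun p => ¬p ∣ N)).card •
              Real.log r := by
              refine Finset.sum_le_card_nsmul _ _ _ fun p hp => ?_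
              simp only [Finset.mem_filter, Finset.mem_Icc] at hp
              exact Real.log_le_log (by exact_mod_cast hp.1.2.pos)
                ((Nat.le_floor_iff (by linarith)).1 hp.1.1.2)
          _ ≤ _ := by
              rw [nsmul_eq_mul]
              exact mul_le_mul_of_nonneg_right (by exact_mod_cast Finset.card_le_card hsub) hlr0.le
      linarith
    calc _ ≤ 1 / 6 * (r / Real.log r) :=
          mul_le_mul_of_nonneg_right (min_le_left _ _) (by positivity)
      _ = r / 6 / Real.log r := by ring
      _ ≤ _ := (div_le_iff₀ hlr0).2 (by linarith)
  · have h1 : (1 : ℝ) ≤ S.card := by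
      have : 1 ∈ S := by
        rw [hS, Finset.mem_filter, Finset.mem_Icc]
        exact ⟨⟨le_rfl, Nat.le_floor (by push_cast; linarith)⟩, Nat.gcd_one_left N⟩
      exact_mod_cast Finset.card_pos.2 ⟨1, this⟩
    refine le_trans ?_ h1
    have h2 : r ≤ max R 1 := (not_le.1 hrR).le.trans (le_max_left _ _)
    calc _ ≤ Real.log 2 / max R 1 * (r / Real.log r) :=
          mul_le_mul_of_nonneg_right (min_le_right _ _) (by positivity)
      _ = (Real.log 2 / Real.log r) * (r / max R 1) := by ring
      _ ≤ 1 * 1 := mul_le_mul ((div_le_one hlr0).2 hlr) ((div_le_one (by positivity)).2 h2)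
          (by positivity) zero_le_one
      _ = 1 := one_mul 1

/-- The coprime numbers up to `r` have squared weight at least `exp(-2π)` and there are at least a
constant times `r / log r` of them; `1 + r ≤ 2r` bounds the normalization. -/
theorem coprimeProb_ge_div_log : ∃ c, 0 < c ∧ ∀ (N B : ℕ) (r : ℝ), 2 ≤ N → 3 * Real.log N ≤ r →
    r ≤ B → c / Real.log r ≤ coprimeProb N r B := by
  obtain ⟨c, hc, h⟩ := card_coprime_ge
  have hG := gaussConst_pos
  refine ⟨c * Real.exp (-2 * Real.pi) / (2 * gaussConst), by positivity, fun N B r hN hr hB => ?_⟩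
  have hlog2 := Real.log_two_gt_d9
  have hN2 : Real.log 2 ≤ Real.log N := Real.log_le_log (by norm_num) (by exact_mod_cast hN)
  have hr2 : 2 ≤ r := by linarith
  have hlr : 0 < Real.log r := Real.log_pos (by linarith)
  refine le_trans ?_ (coprimeProb_ge (w := Real.exp (-2 * Real.pi)) (by linarith)
    (S := (Finset.Icc 1 ⌊r⌋₊).filter fun a => Nat.gcd a N = 1) ?_)
  · rw [le_div_iff₀ (by positivity)]
    calc _ = c * Real.exp (-2 * Real.pi) * ((1 + r) / 2) / Real.log r := by field_simp
      _ ≤ c * Real.exp (-2 * Real.pi) * r / Real.log r := by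
        gcongr
        linarith
      _ = c * (r / Real.log r) * Real.exp (-2 * Real.pi) := by ring
      _ ≤ _ := mul_le_mul_of_nonneg_right (h N r hN hr) (Real.exp_pos _).le
  · intro a ha
    rw [Finset.mem_filter, Finset.mem_Icc] at ha
    have har : (a : ℝ) ≤ r := (Nat.le_floor_iff (by linarith)).1 ha.1.2
    refine ⟨by exact_mod_cast har.trans hB, ha.2, ?_⟩
    rw [rho_sq, Real.exp_le_exp]
    have h1 : ((a : ℤ) : ℝ) / r ≤ 1 := (div_le_one (by linarith)).2 (by exact_mod_cast har)
    have h2 : (0 : ℝ) ≤ ((a : ℤ) : ℝ) / r := div_nonneg (by positivity) (by linarith)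
    have h3 := pow_le_pow_left₀ h2 h1 2
    have := Real.pi_pos
    nlinarith

/-- The expected number of successes is large compared with `ℓ' κ`. -/
theorem exists_const {r₀ : ℝ} (hr₀ : 0 < r₀) : ∃ c : ℝ, 0 < c ∧ ∀ (κ N ℓ ℓ' B : ℕ) (r : ℝ),
    1 ≤ κ → 2 ≤ N → r₀ ≤ r → √(κ : ℝ) * r ≤ (B : ℝ) →
    ((3 * Real.log N ≤ r ∧ (ℓ' : ℝ) ≤ c * (ℓ / (Real.log r * (κ : ℝ) ^ 2))) ∨
      (r < 3 * Real.logb 2 N ∧ (ℓ' : ℝ) ≤ c * (ℓ / (r * κ)))) →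
    ℓ' ≤ ℓ ∧ 4 * (ℓ' : ℝ) * κ ≤ coprimeProb N r B * ℓ := by
  obtain ⟨c₁, hc₁, h₁⟩ := coprimeProb_ge_div_log
  obtain ⟨c₂, hc₂, h₂⟩ := coprimeProb_ge_div hr₀
  -- The bounds `1/2 < log 2 ≤ log r` and `r₀ ≤ r` serve for `ℓ' ≤ ℓ`; the quarters produce the
  -- factor `4` in the expected number of successes.
  refine ⟨min (min (1 / 2) r₀) (min (c₁ / 4) (c₂ / 4)), by positivity,
    fun κ N ℓ ℓ' B r hκ hN hr hB h => ?_⟩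
  set c := min (min (1 / 2) r₀) (min (c₁ / 4) (c₂ / 4)) with hc
  have hc0 : 0 < c := by positivity
  have hca : c ≤ 1 / 2 := (min_le_left _ _).trans (min_le_left _ _)
  have hcb : c ≤ r₀ := (min_le_left _ _).trans (min_le_right _ _)
  have hcc : c ≤ c₁ / 4 := (min_le_right _ _).trans (min_le_left _ _)
  have hcd : c ≤ c₂ / 4 := (min_le_right _ _).trans (min_le_right _ _)
  have hr' : 0 < r := hr₀.trans_le hr
  have hκ' : (1 : ℝ) ≤ κ := by exact_mod_cast hκ
  have hrB : r ≤ B := by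
    have := Real.one_le_sqrt.2 hκ'
    nlinarith
  -- Both regimes are instances, with `L = log r` and `L = r`.
  have key : ∀ L P : ℝ, 0 < L → c ≤ L → 4 * c / L ≤ P → (ℓ' : ℝ) ≤ c * (ℓ / (L * κ)) →
      ℓ' ≤ ℓ ∧ 4 * (ℓ' : ℝ) * κ ≤ P * ℓ := by
    intro L P hL hcL hP h
    have e : c * (ℓ / (L * κ)) * κ = c / L * ℓ := by field_simp
    have h' : (ℓ' : ℝ) * κ ≤ c / L * ℓ := by
      rw [← e]
      exact mul_le_mul_of_nonneg_right h (by linarith)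
    have hℓ : (0 : ℝ) ≤ ℓ := Nat.cast_nonneg _
    have hℓ' : (0 : ℝ) ≤ ℓ' := Nat.cast_nonneg _
    have hcL' : c / L ≤ 1 := (div_le_one hL).2 hcL
    constructor
    · have : (ℓ' : ℝ) ≤ ℓ := by nlinarith
      exact_mod_cast this
    · have := mul_le_mul_of_nonneg_right hP hℓ
      have e2 : 4 * c / L * ℓ = 4 * (c / L * ℓ) := by ring
      linarith
  rcases h with ⟨hN', h⟩ | ⟨-, h⟩
  · have hlog2 := Real.log_two_gt_d9
    have hN2 : Real.log 2 ≤ Real.log N := Real.log_le_log (by norm_num) (by exact_mod_cast hN)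
    have hr2 : 2 ≤ r := by linarith
    have hlr : Real.log 2 ≤ Real.log r := Real.log_le_log (by norm_num) hr2
    refine key (Real.log r) _ (by linarith) (by linarith) ?_ (h.trans ?_)
    · exact (div_le_div_of_nonneg_right (by linarith) (by linarith)).trans (h₁ N B r hN hN' hrB)
    -- A single factor `κ` is enough here, as `κ ≤ κ ^ 2`.
    · refine mul_le_mul_of_nonneg_left (div_le_div_of_nonneg_left (Nat.cast_nonneg _) ?_ ?_) hc0.le
      · exact mul_pos (by linarith) (by linarith)
      · exact mul_le_mul_of_nonneg_left (by nlinarith) (by linarith)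
  · refine key r _ hr' (hcb.trans hr) ?_ h
    refine (div_le_div_of_nonneg_right (by linarith) hr'.le).trans (h₂ N B r hr ?_)
    have : (0 : ℝ) < B := hr'.trans_le hrB
    exact_mod_cast this

/-! ## The call of the solver -/

theorem DCPSolver.prob_nonneg {N ℓ : ℕ} [NeZero N] (A : DCPSolver N ℓ) (t : ZMod N)
    (φ : DCPBasis N ℓ → ℂ) : 0 ≤ A.prob t φ :=
  (A.posSemidef t).re_dotProduct_nonneg φ

theorem DCPSolver.memProb_nonneg {N ℓ : ℕ} [NeZero N] (A : DCPSolver N ℓ) (b : ℕ) (t : ZMod N)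
    (ψ : QVec) : 0 ≤ A.memProb b t ψ :=
  Finset.sum_nonneg fun _ _ => A.prob_nonneg t _

theorem DCPSolver.prob_smul {N ℓ : ℕ} [NeZero N] (A : DCPSolver N ℓ) (t : ZMod N)
    (c : ℂ) (φ : DCPBasis N ℓ → ℂ) : A.prob t (c • φ) = ‖c‖ ^ 2 * A.prob t φ := by
  have h : star c * c = ((‖c‖ ^ 2 : ℝ) : ℂ) := by
    rw [Complex.star_def, mul_comm, Complex.mul_conj, Complex.normSq_eq_norm_sq]
  rw [DCPSolver.prob, DCPSolver.prob, Matrix.mulVec_smul, star_smul, smul_dotProduct,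
    dotProduct_smul, smul_smul, h, smul_eq_mul, Complex.re_ofReal_mul]

theorem dcpCells_apply_of_notMem {N ℓ : ℕ} (b : ℕ) (d : DCPBasis N ℓ) {a : ℕ}
    (ha : ¬(b ≤ a ∧ a < b + 2 * ℓ)) : dcpCells b d a = 0 := by
  rw [dcpCells, Finsupp.finsetSum_apply]
  refine Finset.sum_eq_zero fun i _ => ?_
  have := i.2
  simp only [Finsupp.add_apply, Finsupp.single_apply]
  rw [if_neg (by omega), if_neg (by omega)]
  rfl

theorem dcpCells_apply_bit {N ℓ : ℕ} (b : ℕ) (d : DCPBasis N ℓ) (i : Fin ℓ) :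
    dcpCells b d (b + 2 * i) = (d i).1 := by
  rw [dcpCells, Finsupp.finsetSum_apply, Finset.sum_eq_single i]
  · simp
  · intro j _ hj
    have := Fin.val_ne_of_ne hj
    simp only [Finsupp.add_apply, Finsupp.single_apply]
    rw [if_neg (by omega), if_neg (by omega)]
    rfl
  · simp

theorem dcpCells_apply_val {N ℓ : ℕ} (b : ℕ) (d : DCPBasis N ℓ) (i : Fin ℓ) :
    dcpCells b d (b + 2 * i + 1) = (d i).2.val := by
  rw [dcpCells, Finsupp.finsetSum_apply, Finset.sum_eq_single i]
  · simp
  · intro j _ hj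
    have := Fin.val_ne_of_ne hj
    simp only [Finsupp.add_apply, Finsupp.single_apply]
    rw [if_neg (by omega), if_neg (by omega)]
    rfl
  · simp

theorem dcpCells_injective {N ℓ : ℕ} [NeZero N] (b : ℕ) :
    Function.Injective (dcpCells b : DCPBasis N ℓ → ℕ →₀ ℕ) := by
  intro d d' h
  funext i
  refine Prod.ext (Fin.ext ?_) (ZMod.val_injective N ?_)
  · rw [← dcpCells_apply_bit b d i, h, dcpCells_apply_bit]
  · rw [← dcpCells_apply_val b d i, h, dcpCells_apply_val]

theorem clearCells_add_dcpCells {N ℓ : ℕ} (b : ℕ) (d : DCPBasis N ℓ) {z : ℕ →₀ ℕ}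
    (hz : clearCells b ℓ z = z) : clearCells b ℓ (z + dcpCells b d) = z := by
  have h : clearCells b ℓ (dcpCells b d) = 0 := by
    refine (Finsupp.filter_eq_zero_iff _ _).2 fun a ha => dcpCells_apply_of_notMem b d ha
  rw [clearCells, Finsupp.filter_add, ← clearCells, ← clearCells, hz, h, add_zero]

theorem sum_norm_dcpState_sq {N ℓ : ℕ} [NeZero N] (s : ZMod N) (x : Fin ℓ → ZMod N) :
    ∑ d : DCPBasis N ℓ, ‖dcpState s x d‖ ^ 2 = 1 := by
  have h : ∀ i : Fin ℓ, ∑ e : Fin 2 × ZMod N,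
      ‖if e.2 = x i + (e.1 : ℕ) * s then (((√2)⁻¹ : ℝ) : ℂ) else 0‖ ^ 2 = 1 := by
    intro i
    rw [Fintype.sum_prod_type]
    have h2 : ∀ c : ZMod N, ∑ y : ZMod N,
        ‖if y = c then (((√2)⁻¹ : ℝ) : ℂ) else 0‖ ^ 2 = 1 / 2 := by
      intro c
      rw [Finset.sum_eq_single c]
      · rw [if_pos rfl, Complex.norm_real, Real.norm_eq_abs, sq_abs, inv_pow,
          Real.sq_sqrt (by norm_num)]
        norm_num
      · intro y _ hy
        simp [hy]
      · simp
    simp only [h2, Fin.sum_univ_two]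
    norm_num
  calc _ = ∑ d ∈ Fintype.piFinset fun _ : Fin ℓ => (Finset.univ : Finset (Fin 2 × ZMod N)),
        ∏ i, ‖if (d i).2 = x i + ((d i).1 : ℕ) * s then (((√2)⁻¹ : ℝ) : ℂ) else 0‖ ^ 2 := by
        rw [Fintype.piFinset_univ]
        refine Finset.sum_congr rfl fun d _ => ?_
        rw [dcpState, norm_prod, Finset.prod_pow]
    _ = ∏ i : Fin ℓ, ∑ e : Fin 2 × ZMod N,
        ‖if e.2 = x i + (e.1 : ℕ) * s then (((√2)⁻¹ : ℝ) : ℂ) else 0‖ ^ 2 :=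
        (Finset.prod_univ_sum (fun _ : Fin ℓ => (Finset.univ : Finset (Fin 2 × ZMod N)))
          fun i e => ‖if e.2 = x i + (e.1 : ℕ) * s then (((√2)⁻¹ : ℝ) : ℂ) else 0‖ ^ 2).symm
    _ = 1 := Finset.prod_eq_one fun i _ => h i

theorem dcpState_ne_zero {N ℓ : ℕ} (s : ZMod N) (x : Fin ℓ → ZMod N) :
    dcpState s x (fun i => (0, x i)) ≠ 0 := by
  rw [dcpState]
  refine Finset.prod_ne_zero_iff.2 fun i _ => ?_
  simp

theorem sum_single_apply_of_injOn {ι : Type*} {s : Finset ι} {b : ι → ℕ →₀ ℕ} (c : ι → ℂ)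
    (hb : Set.InjOn b s) {i : ι} (hi : i ∈ s) :
    (∑ j ∈ s, Finsupp.single (b j) (c j)) (b i) = c i := by
  rw [Finsupp.finsetSum_apply, Finset.sum_eq_single i]
  · simp
  · intro j hj hji
    exact Finsupp.single_eq_of_ne fun h => hji (hb hj hi h.symm)
  · exact fun h => absurd hi h

/-- For every basis state `z` of the remaining cells the solver sees the normalized state `dcpState
s x` scaled by `χ z`, and so answers `s` with weight at least `p * ‖χ z‖ ^ 2`. -/
theorem DCPSolver.memProb_ge {N ℓ b : ℕ} [NeZero N] {A : DCPSolver N ℓ} {s : ZMod N} {ψ : QVec}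
    {p : ℝ} (hA : A.SolvesWithProb p) (h : HoldsDCP ℓ b s ψ) :
    p * ψ.normSq ≤ A.memProb b s ψ := by
  classical
  obtain ⟨x, χ, hχ, hψ⟩ := h
  set bb : (ℕ →₀ ℕ) × DCPBasis N ℓ → ℕ →₀ ℕ := fun i => i.1 + dcpCells b i.2 with hbb
  set cc : (ℕ →₀ ℕ) × DCPBasis N ℓ → ℂ := fun i => dcpState s x i.2 * χ i.1 with hcc
  have hinj : Set.InjOn bb
      (χ.support ×ˢ Finset.univ : Finset ((ℕ →₀ ℕ) × DCPBasis N ℓ)) := by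
    rintro ⟨z, d⟩ hz ⟨z', d'⟩ hz' e
    rw [Finset.mem_coe, Finset.mem_product] at hz hz'
    have e1 : z = z' := by
      rw [← clearCells_add_dcpCells b d (hχ z hz.1), ← clearCells_add_dcpCells b d' (hχ z' hz'.1)]
      exact congrArg _ e
    subst e1
    exact Prod.ext rfl (dcpCells_injective b (add_left_cancel e))
  have hψ' : ψ = ∑ i ∈ χ.support ×ˢ Finset.univ, Finsupp.single (bb i) (cc i) := by
    rw [hψ, Finset.sum_product_right]
    refine Finset.sum_congr rfl fun d _ => ?_
    rw [Finsupp.mapDomain, Finsupp.sum, Finset.smul_sum]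
    refine Finset.sum_congr rfl fun z _ => ?_
    rw [Finsupp.smul_single, smul_eq_mul]
  have happ : ∀ z ∈ χ.support, (fun d => ψ (z + dcpCells b d)) = χ z • dcpState s x := by
    intro z hz
    funext d
    have := sum_single_apply_of_injOn cc hinj (i := (z, d)) (by simpa using hz)
    rw [← hψ'] at this
    rw [Pi.smul_apply, smul_eq_mul, mul_comm]
    exact this
  have hnorm : ψ.normSq = χ.normSq := by
    rw [normSq_eq_wsum, hψ', wsum_sum_single _ _ _ _ hinj, Finset.sum_product, QVec.normSq]
    refine Finset.sum_congr rfl fun z _ => ?_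
    simp only [hcc, one_mul, norm_mul, mul_pow]
    rw [← Finset.sum_mul, sum_norm_dcpState_sq, one_mul]
  -- No `z` is lost in the sum defining `memProb`, because `dcpState s x` has a nonzero amplitude at
  -- the all-zero bits.
  have hsub : χ.support ⊆ ψ.support.image (clearCells b ℓ) := by
    intro z hz
    refine Finset.mem_image.2 ⟨z + dcpCells b fun i => ((0 : Fin 2), x i), ?_,
      clearCells_add_dcpCells b _ (hχ z hz)⟩
    rw [Finsupp.mem_support_iff]
    have := congrFun (happ z hz) fun i => ((0 : Fin 2), x i)
    simp only [Pi.smul_apply, smul_eq_mul] at this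
    rw [this]
    exact mul_ne_zero (Finsupp.mem_support_iff.1 hz) (dcpState_ne_zero s x)
  calc p * ψ.normSq = ∑ z ∈ χ.support, ‖χ z‖ ^ 2 * p := by
        rw [hnorm, QVec.normSq, ← Finset.sum_mul, mul_comm]
    _ ≤ ∑ z ∈ χ.support, A.prob s fun d => ψ (z + dcpCells b d) := by
        refine Finset.sum_le_sum fun z hz => ?_
        rw [happ z hz, DCPSolver.prob_smul]
        exact mul_le_mul_of_nonneg_left (hA s x) (by positivity)
    _ ≤ _ := Finset.sum_le_sum_of_subset_of_nonneg hsub fun z _ _ => A.prob_nonneg _ _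

/-! ## Halving the answer of the solver -/

theorem outProb_nonneg (S : Multiset State) (v : ℕ) : 0 ≤ outProb S v := by
  refine Multiset.sum_nonneg fun a ha => ?_
  obtain ⟨σ, -, rfl⟩ := Multiset.mem_map.1 ha
  split_ifs <;> [exact normSq_nonneg _; exact le_rfl]

theorem normSq_single (q : ℕ →₀ ℕ) (c : ℂ) : QVec.normSq (Finsupp.single q c) = ‖c‖ ^ 2 := by
  rw [normSq_eq_wsum, wsum, Finsupp.sum_single_index (by simp), one_mul]

theorem hadamard_single_zero : QVec.hadamard 0 (Finsupp.single 0 1) =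
    Finsupp.single 0 (1 / (√2 : ℝ) : ℂ) +
      Finsupp.single (Finsupp.single 0 1) (1 / (√2 : ℝ) : ℂ) := by
  rw [QVec.hadamard, Finsupp.sum_single_index (by simp)]
  have h0 : (0 : ℕ →₀ ℕ).update 0 0 = 0 := by simp
  have h1 : (0 : ℕ →₀ ℕ).update 0 1 = Finsupp.single 0 1 := by
    simp
  rw [if_pos (by simp), h0, h1]
  simp

theorem normSq_filter_hadamard {v : ℕ} (hv : v ≤ 1) :
    v ∈ (QVec.hadamard 0 (Finsupp.single 0 1)).support.image (fun q => q 0) ∧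
      QVec.normSq ((QVec.hadamard 0 (Finsupp.single 0 1)).filter fun q => q 0 = v) = 1 / 2 := by
  have hf : (QVec.hadamard 0 (Finsupp.single 0 1)).filter (fun q => q 0 = v) =
      Finsupp.single (Finsupp.single 0 v) (1 / (√2 : ℝ) : ℂ) := by
    rw [hadamard_single_zero, Finsupp.filter_add]
    interval_cases v
    · rw [Finsupp.filter_single_of_pos _ (by simp), Finsupp.filter_single_of_neg _ (by simp)]
      simp
    · rw [Finsupp.filter_single_of_neg _ (by simp), Finsupp.filter_single_of_pos _ (by simp)]
      simp
  have hc : (1 / (√2 : ℝ) : ℂ) ≠ 0 := by simp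
  constructor
  · refine Finset.mem_image.2 ⟨Finsupp.single 0 v, ?_, by simp⟩
    have : Finsupp.single 0 v ∈ ((QVec.hadamard 0 (Finsupp.single 0 1)).filter
        (fun q => q 0 = v)).support := by
      rw [hf, Finsupp.mem_support_iff, Finsupp.single_eq_same]
      exact hc
    rw [Finsupp.support_filter] at this
    exact (Finset.mem_filter.1 this).1
  · rw [hf, normSq_single, norm_div, Complex.norm_real, norm_one, div_pow, Real.norm_eq_abs,
      sq_abs, Real.sq_sqrt (by norm_num)]
    norm_num

theorem halve_odd {N : ℕ} [NeZero N] (hN : N % 2 = 1) (s : ZMod N) :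
    (2 * s).val * ((N + 1) / 2) % N = s.val := by
  rw [mul_comm]
  refine mul_val_mod _ _ _ ?_
  have h : (2 * ((N + 1) / 2) : ℕ) = N + 1 := by omega
  have h' := congrArg (Nat.cast : ℕ → ZMod N) h
  push_cast at h'
  rw [CharP.cast_eq_zero (ZMod N) N] at h'
  linear_combination s * h'

/-- The representative of `2s` is `2 * s.val` or `2 * s.val - N`, so its half is `s.val` or `s.val -
N / 2`. -/
theorem halve_even {N : ℕ} [NeZero N] (hN : N % 2 = 0) (s : ZMod N) :
    ∃ v ≤ 1, ((2 * s).val / 2 + v * (N / 2)) % N = s.val := by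
  have h := mul_val_mod 2 s (2 * s) (by norm_num)
  have hs := ZMod.val_lt s
  have hN' := NeZero.pos N
  rw [← h]
  by_cases h2 : 2 * s.val < N
  · refine ⟨0, by omega, ?_⟩
    rw [Nat.mod_eq_of_lt h2, Nat.mod_eq_of_lt (by omega)]
    omega
  · refine ⟨1, le_rfl, ?_⟩
    have e : 2 * s.val % N = 2 * s.val - N := by
      rw [Nat.mod_eq_sub_mod (by omega), Nat.mod_eq_of_lt (by omega)]
    rw [e, Nat.mod_eq_of_lt (by omega)]
    omega

/-- For odd `N` the half is unique and found with certainty. For even `N` one of the two coin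
outcomes yields `s`, and the nonnegative contribution of the other is dropped. -/
theorem postProg_spec {N : ℕ} [NeZero N] {n ℓ ℓ' κ k m v r₀ r₁ t₀ t₁ x y : ℕ} (t : ZMod N)
    (h : ∀ a ∈ [t.val, N, ℓ, ℓ', κ, k, m, v, r₀, r₁, t₀, t₁, x, y], a < 2 ^ n)
    (hn : 1 ≤ n) (T : ℕ) :
    (∀ τ ∈ postProg.exec ⟨mem [t.val, N, ℓ, ℓ', κ, k, m, v, r₀, r₁, t₀, t₁, x, y],
        Finsupp.single 0 1, T⟩, τ.time ≤ T + postProg.weight * (n + 1)) ∧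
      ∀ s : ZMod N, 2 * s = t →
        1 / 2 ≤ outProb (postProg.exec ⟨mem [t.val, N, ℓ, ℓ', κ, k, m, v, r₀, r₁, t₀, t₁, x, y],
          Finsupp.single 0 1, T⟩) s.val := by
  have hc := mem_lt h
  by_cases hN : N % 2 = 1
  · have hr : Runs (n + 1) postProg.weight postProg
        (mem [t.val, N, ℓ, ℓ', κ, k, m, v, r₀, r₁, t₀, t₁, x, y]) (Finsupp.single 0 1)
        (mem [t.val * ((N + 1) / 2) % N, N, ℓ, ℓ', κ, k, m, v, r₀, r₁, t₀, t₁, x, y])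
        (Finsupp.single 0 1) := by
      refine Runs.ite_pos hc le_rfl ?_ (Runs.assign_mem h le_rfl (by simp) rfl rfl _)
      change N % 2 ≠ 0
      omega
    obtain ⟨T', hT', e⟩ := hr T
    rw [e]
    refine ⟨fun τ hτ => ?_, fun s hs => ?_⟩
    · rw [Multiset.mem_singleton.1 hτ]
      exact hT'
    · subst hs
      have hm : mem [(2 * s).val * ((N + 1) / 2) % N, N, ℓ, ℓ', κ, k, m, v, r₀, r₁, t₀, t₁, x, y] 0
          = s.val := halve_odd hN s
      rw [outProb, Multiset.map_singleton, Multiset.sum_singleton]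
      simp only
      rw [if_pos hm, normSq_single]
      norm_num
  · have hN0 : N % 2 = 0 := by omega
    set c := mem [t.val, N, ℓ, ℓ', κ, k, m, v, r₀, r₁, t₀, t₁, x, y] with hcdef
    set e := CExpr.op .mod (CExpr.op .add (CExpr.op .div (cell 0) (.lit 2))
      (CExpr.op .mul (cell 12) (CExpr.op .div (cell 1) (.lit 2)))) (cell 1) with he
    set ψ := QVec.hadamard 0 (Finsupp.single 0 1) with hψ
    set T₁ := T + ((CExpr.op .mod (cell 1) (.lit 2)).cost c + 1) + ((CExpr.lit 0).cost c + 1)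
      with hT₁
    set τ : ℕ → State := fun w =>
      { cmem := Function.update (Function.update c 12 w) 0 ((t.val / 2 + w * (N / 2)) % N)
        qmem := ψ.filter fun q => q 0 = w
        time := T₁ + ((CExpr.lit 12).cost c + (CExpr.lit 0).cost c + 1 + Nat.size w) +
          ((CExpr.lit 0).cost (Function.update c 12 w) + e.cost (Function.update c 12 w) + 1) }
      with hτ
    have hexec : postProg.exec ⟨c, Finsupp.single 0 1, T⟩ =
        (ψ.support.image fun q => q 0).val.map τ := by
      have h0 : (CExpr.op .mod (cell 1) (.lit 2)).eval c = 0 := hN0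
      rw [postProg, Prog.exec, if_neg (by simpa using h0)]
      simp only [Prog.exec, State.tick, Multiset.singleton_bind]
      rw [Multiset.bind_map, Multiset.bind_singleton]
      rfl
    rw [hexec]
    have h1w : ∀ w ∈ ψ.support.image fun q => q 0, w ≤ 1 := by
      intro w hw
      obtain ⟨q, hq, rfl⟩ := Finset.mem_image.1 hw
      rw [hψ, hadamard_single_zero] at hq
      rcases Finset.mem_union.1 (Finsupp.support_add hq) with h | h
      · rw [Finset.mem_singleton.1 (Finsupp.support_single_subset h)]
        simp
      · rw [Finset.mem_singleton.1 (Finsupp.support_single_subset h)]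
        simp
    refine ⟨fun σ hσ => ?_, fun s hs => ?_⟩
    · obtain ⟨w, hw, rfl⟩ := Multiset.mem_map.1 hσ
      have hw1 := h1w w hw
      have h2n : 2 ≤ 2 ^ n := by
        calc 2 = 2 ^ 1 := rfl
          _ ≤ 2 ^ n := Nat.pow_le_pow_right (by norm_num) hn
      have hc' : ∀ a, Function.update c 12 w a < 2 ^ n := by
        intro a
        by_cases ha : a = 12
        · subst ha
          rw [Function.update_self]
          omega
        · rw [Function.update_of_ne ha]
          exact hc a
      have g1 := CExpr.cost_le hc (.op .mod (cell 1) (.lit 2)) le_rfl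
      have g2 := CExpr.cost_le hc (.lit 0) le_rfl
      have g3 := CExpr.cost_le hc (.lit 12) le_rfl
      have g4 := CExpr.cost_le hc' (.lit 0) le_rfl
      have g5 := CExpr.cost_le hc' e le_rfl
      have g6 : Nat.size w ≤ n := Nat.size_le.2 (by omega)
      rw [he] at g5
      simp only [hτ, hT₁, he, postProg, Prog.weight, add_mul, one_mul]
      omega
    · subst hs
      obtain ⟨w, hw, hw'⟩ := halve_even hN0 s
      obtain ⟨hmem, hnorm⟩ := normSq_filter_hadamard hw
      rw [outProb, Multiset.map_map]
      change 1 / 2 ≤ ∑ w ∈ ψ.support.image fun q => q 0, _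
      refine le_trans ?_ (Finset.single_le_sum (fun w _ => ?_) hmem)
      · simp only [Function.comp_apply, hτ, Function.update_self]
        rw [if_pos hw', hnorm]
      · simp only [Function.comp_apply]
        split_ifs <;> [exact normSq_nonneg _; exact le_rfl]

/-! ## The reduction -/

section

variable {N : ℕ} {r : ℝ} {B : ℕ} {s : ZMod N} {X : ℕ → ZMod N}

theorem prod_edcpReg_livesOn (m : ℕ) :
    LivesOn {a | a < 3 * m} (∏ i ∈ Finset.range m, edcpReg r B s (X i) i) := by
  refine LivesOn.prod fun i hi => (edcpReg_livesOn _ _ _ _ _).mono fun a ha => ?_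
  rw [Finset.mem_range] at hi
  rw [Set.mem_ofPred_eq] at ha ⊢
  omega

theorem edcpReg_livesOn_compl (m : ℕ) :
    LivesOn {a | a < 3 * m}ᶜ (edcpReg r B s (X m) m) := by
  refine (edcpReg_livesOn _ _ _ _ _).mono fun a ha => ?_
  rw [Set.mem_compl_iff, Set.mem_ofPred_eq]
  rw [Set.mem_ofPred_eq] at ha
  omega

theorem normSq_prod_edcpReg (m : ℕ) :
    QVec.normSq (∏ i ∈ Finset.range m, edcpReg r B s (X i) i).coeff = 1 := by
  induction m with
  | zero =>
    rw [Finset.prod_range_zero, AddMonoidAlgebra.one_def, AddMonoidAlgebra.coeff_single,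
      normSq_single]
    simp
  | succ m ih =>
    rw [Finset.prod_range_succ, normSq_mul (prod_edcpReg_livesOn m) (edcpReg_livesOn_compl m), ih,
      normSq_edcpReg, one_mul]

theorem gEDCPState_eq_prod_range {ℓ : ℕ} (x : Fin ℓ → ZMod N) :
    ∃ X : ℕ → ZMod N, gEDCPState r B s x =
      (∏ i ∈ Finset.range ℓ, edcpReg r B s (X i) i).coeff := by
  refine ⟨fun i => if h : i < ℓ then x ⟨i, h⟩ else 0, ?_⟩
  rw [gEDCPState_eq_prod, Finset.prod_range]
  simp

variable [NeZero N]

theorem edcpReg_lt {n : ℕ} (hn : 1 ≤ n) (hN : N < 2 ^ n) (hB : B < 2 ^ n) (x : ZMod N) (k : ℕ) :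
    ∀ q ∈ (edcpReg r B s x k).coeff.support, ∀ a, q a < 2 ^ n := by
  classical
  intro q hq a
  rw [edcpReg, AddMonoidAlgebra.coeff_sum] at hq
  obtain ⟨j, hj, hq⟩ := Finset.mem_biUnion.1 (Finsupp.support_finsetSum hq)
  rw [AddMonoidAlgebra.coeff_single] at hq
  rw [Finset.mem_singleton.1 (Finsupp.support_single_subset hq)]
  have h2n : 2 ≤ 2 ^ n := by
    calc 2 = 2 ^ 1 := rfl
      _ ≤ 2 ^ n := Nat.pow_le_pow_right (by norm_num) hn
  have hy := ZMod.val_lt (x + (j : ZMod N) * s)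
  rw [Finset.mem_Icc] at hj
  simp only [edcpCell, Finsupp.add_apply, Finsupp.single_apply]
  split_ifs <;> omega

theorem prod_edcpReg_lt {n : ℕ} (hn : 1 ≤ n) (hN : N < 2 ^ n) (hB : B < 2 ^ n) (m : ℕ) :
    ∀ q ∈ (∏ i ∈ Finset.range m, edcpReg r B s (X i) i).coeff.support, ∀ a, q a < 2 ^ n := by
  induction m with
  | zero =>
    intro q hq a
    rw [Finset.prod_range_zero] at hq
    rw [LivesOn.one ∅ q hq a (Set.notMem_empty a)]
    positivity
  | succ m ih =>
    intro q hq a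
    rw [Finset.prod_range_succ] at hq
    obtain ⟨p, hp, p', hp', rfl⟩ := Poly.mem_support_mul hq
    rw [Finsupp.add_apply]
    by_cases ha : a < 3 * m
    · rw [edcpReg_livesOn_compl m p' hp' a (not_not_intro ha), add_zero]
      exact ih p hp a
    · rw [prod_edcpReg_livesOn m p hp a ha, zero_add]
      exact edcpReg_lt hn hN hB _ _ p' hp' a

theorem loopInv_init {n ℓ ℓ' κ T : ℕ} (hn : 1 ≤ n) (hN : N < 2 ^ n) (hB : B < 2 ^ n)
    (hℓ : ℓ < 2 ^ n) (hℓ' : ℓ' < 2 ^ n) (hκ : κ < 2 ^ n) :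
    LoopInv n ℓ ℓ' κ r B s X T 0
      ((initState κ N ℓ ℓ' (∏ i ∈ Finset.range ℓ, edcpReg r B s (X i) i).coeff).tick T) where
  cmem := by
    refine ⟨0, 0, 0, 0, 0, 0, 0, 0, le_rfl, ?_, ?_⟩
    · funext a
      simp only [initState, State.tick, mem]
      rcases a with _ | _ | _ | _ | _ | _ | _ | _ | _ | _ | _ | _ | _ | _ | a
      all_goals simp
    · simp only [List.forall_mem_cons, forall_mem_nil_iff, and_true]
      omega
  time := by simp [initState, State.tick]
  lt := prod_edcpReg_lt hn hN hB ℓ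
  qmem := by
    refine ⟨fun _ => 0, 1, LivesOn.one _, ?_⟩
    change _ = ((∏ i ∈ Finset.range 0, dcpReg (2 * s) (0 : ZMod N) (3 * ℓ + 2 * i)) *
      (∏ i ∈ Finset.Ico 0 ℓ, edcpReg r B s (X i) i) * 1 : Poly).coeff
    rw [Finset.prod_range_zero, one_mul, mul_one, ← Finset.range_eq_Ico]
    rfl

/-- Surplus coset states beyond the first `ℓ'` lie behind the registers of the solver and are
counted as part of the rest. -/
theorem LoopInv.holdsDCP {n ℓ ℓ' κ T : ℕ} {σ : State} (h : LoopInv n ℓ ℓ' κ r B s X T ℓ σ)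
    (hσ : ℓ' ≤ σ.cmem 6) : HoldsDCP ℓ' (3 * ℓ) (2 * s) σ.qmem := by
  obtain ⟨x', χ, hχ, e⟩ := h.qmem
  rw [Finset.Ico_self, Finset.prod_empty, mul_one, ← Finset.prod_range_mul_prod_Ico _ hσ,
    mul_assoc, Finset.prod_range] at e
  rw [e]
  refine holdsDCP_of_eq (x := fun i => x' i) (LivesOn.mul ?_ (hχ.mono fun a ha => ?_))
  · refine LivesOn.prod fun i hi => (dcpReg_livesOn _ _ _).mono fun a ha => ?_
    rw [Finset.mem_Ico] at hi
    rw [Set.mem_ofPred_eq] at ha ⊢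
    omega
  · rw [Set.mem_ofPred_eq] at ha ⊢
    omega

/-- The states after the main loop. -/
theorem preProg_spec {n ℓ ℓ' κ : ℕ} (hN2 : 2 ≤ N) (hn : 1 ≤ n) (hN : N < 2 ^ n) (hB : B < 2 ^ n)
    (hℓ : ℓ < 2 ^ n) (hℓ' : ℓ' < 2 ^ n) (hκ : κ < 2 ^ n) (x : Fin ℓ → ZMod N) :
    ∃ (X : ℕ → ZMod N),
      (∀ σ ∈ preProg.exec (initState κ N ℓ ℓ' (gEDCPState r B s x)),
        LoopInv n ℓ ℓ' κ r B s X ((cell 2).weight * (n + 1) + 1) ℓ σ) ∧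
      ∀ z : ℝ, ((preProg.exec (initState κ N ℓ ℓ' (gEDCPState r B s x))).map
          fun σ => z ^ σ.cmem 6 * σ.qmem.normSq).sum =
        (1 - coprimeProb N r B + z * coprimeProb N r B) ^ ℓ := by
  obtain ⟨X, hX⟩ := gEDCPState_eq_prod_range (r := r) (B := B) (s := s) x
  refine ⟨X, ?_⟩
  rw [hX]
  set σ₀ := initState κ N ℓ ℓ' (∏ i ∈ Finset.range ℓ, edcpReg r B s (X i) i).coeff with hσ₀
  set T := (cell 2).cost σ₀.cmem + 1 with hT
  set T' := (cell 2).weight * (n + 1) + 1 with hT'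
  have hinit : LoopInv n ℓ ℓ' κ r B s X T 0 (σ₀.tick T) := loopInv_init hn hN hB hℓ hℓ' hκ
  have hTT : T ≤ T' := by
    obtain ⟨m, v, r₀, r₁, t₀, t₁, x, y, -, hc, hb⟩ := hinit.cmem
    have hc' : ∀ a, σ₀.cmem a < 2 ^ n := by
      intro a
      have := mem_lt hb a
      rw [← hc] at this
      exact this
    have := CExpr.cost_le hc' (cell 2) le_rfl
    omega
  have key : ∀ k ≤ ℓ,
      (∀ σ ∈ (fun S : Multiset State => S.bind fun τ => registerStep.exec (τ.tick 1))^[k]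
        {σ₀.tick T}, LoopInv n ℓ ℓ' κ r B s X T' k σ) ∧
      ∀ z : ℝ, (((fun S : Multiset State => S.bind fun τ => registerStep.exec (τ.tick 1))^[k]
        {σ₀.tick T}).map fun σ => z ^ σ.cmem 6 * σ.qmem.normSq).sum =
        (1 - coprimeProb N r B + z * coprimeProb N r B) ^ k := by
    intro k hk
    induction k with
    | zero =>
      constructor
      · intro σ hσ
        rw [Function.iterate_zero, id_eq, Multiset.mem_singleton] at hσ
        subst hσ
        exact { hinit with time := hinit.time.trans (by omega) }
      · intro z
        rw [Function.iterate_zero, id_eq, Multiset.map_singleton, Multiset.sum_singleton, pow_zero]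
        change z ^ 0 * QVec.normSq (∏ i ∈ Finset.range ℓ, edcpReg r B s (X i) i).coeff = 1
        rw [normSq_prod_edcpReg, pow_zero, one_mul]
    | succ k ih =>
      obtain ⟨ih1, ih2⟩ := ih (by omega)
      rw [Function.iterate_succ_apply']
      constructor
      · intro σ hσ
        obtain ⟨τ, hτ, hσ⟩ := Multiset.mem_bind.1 hσ
        obtain ⟨τ', h1, h2⟩ := (ih1 τ hτ).exec_step (by omega) hN2
        rw [h1] at hσ
        obtain ⟨v, hv, rfl⟩ := Multiset.mem_map.1 hσ
        exact (h2 v hv).1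
      · intro z
        -- Every state reached so far contributes the same factor, whatever its history.
        rw [Multiset.map_bind, Multiset.sum_bind,
          Multiset.map_congr rfl fun τ hτ => (ih1 τ hτ).sum_step (by omega) hN2 z,
          Multiset.sum_map_mul_left, ih2, pow_succ, mul_comm]
  have e : preProg.exec σ₀ =
      (fun S : Multiset State => S.bind fun τ => registerStep.exec (τ.tick 1))^[ℓ] {σ₀.tick T} := rfl
  rw [e]
  exact key ℓ le_rfl

end

/-- From `1 - t ≤ exp(-t)` and `2 ≤ e` the left side is at most `exp(ℓ' - 2ℓ'κ)`, and `ℓ' - 2ℓ'κ ≤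
-κ` because `ℓ'` and `κ` are at least `1`. -/
theorem failure_le {P : ℝ} (hP : P ≤ 1) {κ ℓ ℓ' : ℕ} (hκ : 1 ≤ κ) (hℓ' : 1 ≤ ℓ')
    (h : 4 * (ℓ' : ℝ) * κ ≤ P * ℓ) :
    (2 : ℝ) ^ ℓ' * (1 - P / 2) ^ ℓ ≤ (2 : ℝ) ^ (-(1 * (κ : ℝ))) := by
  have hκ' : (1 : ℝ) ≤ κ := by exact_mod_cast hκ
  have hℓ'' : (1 : ℝ) ≤ ℓ' := by exact_mod_cast hℓ'
  have h1 : (1 - P / 2) ^ ℓ ≤ Real.exp (-(2 * ℓ' * κ)) := by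
    calc _ ≤ Real.exp (-(P / 2)) ^ ℓ := by
          refine pow_le_pow_left₀ (by linarith) ?_ _
          linarith [Real.add_one_le_exp (-(P / 2))]
      _ = Real.exp (ℓ * -(P / 2)) := (Real.exp_nat_mul _ _).symm
      _ ≤ _ := Real.exp_le_exp.2 (by linarith)
  have h2 : (2 : ℝ) ^ ℓ' ≤ Real.exp ℓ' := by
    calc (2 : ℝ) ^ ℓ' ≤ Real.exp 1 ^ ℓ' :=
          pow_le_pow_left₀ (by norm_num) (by linarith [Real.exp_one_gt_d9]) _
      _ = Real.exp ℓ' := by rw [← Real.exp_nat_mul, mul_one]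
  have h3 : Real.exp (-(κ : ℝ)) ≤ (2 : ℝ) ^ (-(1 * (κ : ℝ))) := by
    rw [Real.rpow_def_of_pos (by norm_num), Real.exp_le_exp]
    have := Real.log_two_lt_d9
    nlinarith
  calc _ ≤ Real.exp ℓ' * Real.exp (-(2 * ℓ' * κ)) :=
        mul_le_mul h2 h1 (pow_nonneg (by linarith) _) (Real.exp_pos _).le
    _ = Real.exp (ℓ' - 2 * ℓ' * κ) := by rw [← Real.exp_add]; ring_nf
    _ ≤ Real.exp (-(κ : ℝ)) := Real.exp_le_exp.2 (by nlinarith)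
    _ ≤ _ := h3

/-- A factor for the running time of the reduction. -/
def totalWeight : ℕ := (cell 2).weight + 1 + stepWeight + postProg.weight

end CosetReduction

end

open CosetReduction in
theorem mainTheorem10 :
    ∃ (pre post : CosetReduction.Prog) (T : Polynomial ℕ),
      ∀ r₀ : ℝ, 0 < r₀ → ∃ c δ : ℝ, 0 < c ∧ 0 < δ ∧
        ∀ (κ N ℓ ℓ' B : ℕ) [NeZero N] (r : ℝ),
          1 ≤ κ → 2 ≤ N → r₀ ≤ r → √(κ : ℝ) * r ≤ (B : ℝ) →
          ((3 * Real.log N ≤ r ∧ (ℓ' : ℝ) ≤ c * (ℓ / (Real.log r * (κ : ℝ) ^ 2))) ∨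
            (r < 3 * Real.logb 2 N ∧ (ℓ' : ℝ) ≤ c * (ℓ / (r * κ)))) →
          ∀ (s : ZMod N) (x : Fin ℓ → ZMod N),
            CosetReduction.RunsInTime pre post κ N ℓ ℓ' (CosetReduction.gEDCPState r B s x)
              (T.eval (κ + ℓ + Nat.size N + Nat.size B)) ∧
            1 - (2 : ℝ) ^ (-(δ * κ)) ≤
              CosetReduction.dcpOutputProb pre κ ℓ ℓ' (CosetReduction.gEDCPState r B s x) (2 * s) ∧
            ∀ (A : CosetReduction.DCPSolver N ℓ') (p : ℝ), A.SolvesWithProb p →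
              p / 2 * (1 - (2 : ℝ) ^ (-(δ * κ))) ≤
                CosetReduction.successProb pre post A κ ℓ (CosetReduction.gEDCPState r B s x) s := by
  -- The three factors `n + 1` bound the number of registers, the Euclidean iterations and the cost
  -- of an instruction, up to constants.
  refine ⟨preProg, postProg, Polynomial.C totalWeight * (Polynomial.X + 1) ^ 3, fun r₀ hr₀ => ?_⟩
  obtain ⟨c, hc, hconst⟩ := exists_const hr₀
  refine ⟨c, 1, hc, one_pos, fun κ N ℓ ℓ' B _ r hκ hN hr hB h s x => ?_⟩
  obtain ⟨hℓℓ, hP⟩ := hconst κ N ℓ ℓ' B r hκ hN hr hB h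
  set n := κ + ℓ + Nat.size N + Nat.size B with hn
  have hlt : ∀ {a b : ℕ}, Nat.size a ≤ b → b ≤ n → a < 2 ^ n := fun h h' =>
    Nat.size_le.1 (h.trans h')
  have hsize : ∀ a : ℕ, Nat.size a ≤ a := fun a => Nat.size_le.2 Nat.lt_two_pow_self
  have hNn : N < 2 ^ n := hlt le_rfl (by omega)
  have hBn : B < 2 ^ n := hlt le_rfl (by omega)
  have hℓn : ℓ < 2 ^ n := hlt (hsize ℓ) (by omega)
  have hℓn' : ℓ' < 2 ^ n := hℓℓ.trans_lt hℓn
  have hκn : κ < 2 ^ n := hlt (hsize κ) (by omega)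
  obtain ⟨X, hI, hgen⟩ := preProg_spec (r := r) (s := s) hN (by omega : 1 ≤ n) hNn hBn
    hℓn hℓn' hκn x
  have hpost : ∀ σ ∈ preProg.exec (initState κ N ℓ ℓ' (gEDCPState r B s x)), ∀ t : ZMod N,
      (∀ τ ∈ postProg.exec (answerState t σ), τ.time ≤ σ.time + postProg.weight * (n + 1)) ∧
      ∀ s : ZMod N, 2 * s = t → 1 / 2 ≤ outProb (postProg.exec (answerState t σ)) s.val := by
    intro σ hσ t
    obtain ⟨m, v, r₀, r₁, t₀, t₁, x, y, -, hcm, hb⟩ := (hI σ hσ).cmem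
    have ht : t.val < 2 ^ n := (ZMod.val_lt t).trans hNn
    simp only [List.forall_mem_cons, forall_mem_nil_iff, and_true] at hb
    have := postProg_spec (n := n) (ℓ := ℓ) (ℓ' := ℓ') (κ := κ) (k := ℓ) (m := m) (v := v)
      (r₀ := r₀) (r₁ := r₁) (t₀ := t₀) (t₁ := t₁) (x := x) (y := y) t
      (by simp only [List.forall_mem_cons, forall_mem_nil_iff, and_true]; omega) (by omega) σ.time
    rw [answerState, hcm, update_mem (by simp)]
    exact this
  have hprob : 1 - (2 : ℝ) ^ (-(1 * (κ : ℝ))) ≤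
      dcpOutputProb preProg κ ℓ ℓ' (gEDCPState r B s x) (2 * s) := by
    -- For `ℓ' = 0` the tail estimate is void, but every final state holds the empty family of coset
    -- states.
    rcases Nat.eq_zero_or_pos ℓ' with h0 | h0
    · have h1 := hgen 1
      rw [one_mul, sub_add_cancel, one_pow] at h1
      rw [dcpOutputProb, Multiset.map_congr rfl (g := fun σ => 1 ^ σ.cmem 6 * σ.qmem.normSq)
        fun σ hσ => by
          rw [if_pos ((hI σ hσ).holdsDCP (by omega)), one_pow, one_mul], h1]
      have : 0 < (2 : ℝ) ^ (-(1 * (κ : ℝ))) := by positivity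
      linarith
    · have h1 := hgen 1
      -- Chernoff's method at `z = 1/2`: the indicator of fewer than `ℓ'` successes is at most `2 ^
      -- ℓ' * (1 / 2) ^ successes`, while `z = 1` gives the total probability.
      have h2 := hgen (1 / 2)
      rw [one_mul, sub_add_cancel, one_pow] at h1
      have h3 := failure_le (coprimeProb_le_one N r B) hκ h0 hP
      have h4 : (1 - coprimeProb N r B + 1 / 2 * coprimeProb N r B) = 1 - coprimeProb N r B / 2 := by
        ring
      rw [h4] at h2
      calc _ ≤ 1 - (2 : ℝ) ^ ℓ' * (1 - coprimeProb N r B / 2) ^ ℓ := by linarith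
        _ = ((preProg.exec (initState κ N ℓ ℓ' (gEDCPState r B s x))).map fun σ =>
            1 ^ σ.cmem 6 * σ.qmem.normSq -
              2 ^ ℓ' * ((1 / 2 : ℝ) ^ σ.cmem 6 * σ.qmem.normSq)).sum := by
            rw [Multiset.sum_map_sub, Multiset.sum_map_mul_left, h1, h2]
        _ ≤ _ := by
            refine Multiset.sum_map_le_sum_map _ _ fun σ hσ => ?_
            have hs := normSq_nonneg σ.qmem
            have hpos : 0 ≤ (2 : ℝ) ^ ℓ' * ((1 / 2 : ℝ) ^ σ.cmem 6 * σ.qmem.normSq) := by positivity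
            by_cases hcnt : ℓ' ≤ σ.cmem 6
            · rw [if_pos ((hI σ hσ).holdsDCP hcnt), one_pow, one_mul]
              linarith
            · have h5 : (1 : ℝ) ≤ 2 ^ ℓ' * (1 / 2 : ℝ) ^ σ.cmem 6 := by
                rw [one_div, inv_pow, ← div_eq_mul_inv, one_le_div (by positivity)]
                exact pow_le_pow_right₀ (by norm_num) (by omega)
              rw [one_pow, one_mul]
              refine le_trans (b := 0) (by nlinarith) ?_
              split_ifs <;> [exact hs; exact le_rfl]
  refine ⟨fun σ hσ => ?_, hprob, fun A p hA => ?_⟩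
  · have h1 := (hI σ hσ).time
    have e1 : n + 1 ≤ (n + 1) ^ 3 := Nat.le_self_pow (by norm_num) _
    have e2 : ℓ * (stepWeight * ((n + 1) * (n + 1))) ≤ stepWeight * (n + 1) ^ 3 := by
      calc ℓ * (stepWeight * ((n + 1) * (n + 1))) ≤
          (n + 1) * (stepWeight * ((n + 1) * (n + 1))) := Nat.mul_le_mul_right _ (by omega)
        _ = _ := by ring
    have e3 := Nat.mul_le_mul_left (cell 2).weight e1
    have e4 := Nat.mul_le_mul_left postProg.weight e1
    have e5 : Polynomial.eval n (Polynomial.C totalWeight * (Polynomial.X + 1) ^ 3) =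
        (cell 2).weight * (n + 1) ^ 3 + (n + 1) ^ 3 + stepWeight * (n + 1) ^ 3 +
          postProg.weight * (n + 1) ^ 3 := by
      simp [totalWeight]
      ring
    rw [e5]
    refine ⟨by omega, fun t τ hτ => ?_⟩
    have := (hpost σ hσ t).1 τ hτ
    omega
  · have hδ : (2 : ℝ) ^ (-(1 * (κ : ℝ))) ≤ 1 :=
      Real.rpow_le_one_of_one_le_of_nonpos (by norm_num) (by simp)
    have hterm : ∀ σ t, 0 ≤ A.memProb (3 * ℓ) t σ.qmem *
        outProb (postProg.exec (answerState t σ)) s.val :=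
      fun σ t => mul_nonneg (A.memProb_nonneg _ _ _) (outProb_nonneg _ _)
    -- A negative `p` is allowed but makes the claim trivial; the main estimate multiplies by `p / 2
    -- ≥ 0`.
    rcases lt_or_ge p 0 with hp | hp
    · have h0 : 0 ≤ successProb preProg postProg A κ ℓ (gEDCPState r B s x) s := by
        refine Multiset.sum_nonneg fun a ha => ?_
        obtain ⟨σ, -, rfl⟩ := Multiset.mem_map.1 ha
        exact Finset.sum_nonneg fun t _ => hterm σ t
      nlinarith
    · calc p / 2 * (1 - (2 : ℝ) ^ (-(1 * (κ : ℝ)))) ≤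
          p / 2 * dcpOutputProb preProg κ ℓ ℓ' (gEDCPState r B s x) (2 * s) :=
            mul_le_mul_of_nonneg_left hprob (by linarith)
        _ ≤ _ := by
            rw [dcpOutputProb, ← Multiset.sum_map_mul_left]
            refine Multiset.sum_map_le_sum_map _ _ fun σ hσ => ?_
            split_ifs with hH
            · refine le_trans ?_ (Finset.single_le_sum (fun t _ => hterm σ t)
                (Finset.mem_univ (2 * s)))
              have h1 := DCPSolver.memProb_ge hA hH
              have h2 := (hpost σ hσ (2 * s)).2 s rfl
              have h3 := mul_le_mul h1 h2 (by norm_num) (A.memProb_nonneg _ _ _)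
              linarith
            · rw [mul_zero]
              exact Finset.sum_nonneg fun t _ => hterm σ t
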